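/- Let $p$ be a prime, let $A$ be the ring of integers of a finite extension $E$ of $\mathbb{Q}_p$ with uniformizer $\pi$ and residue field $\mathbb{F}_q$, and let $R$ be a complete discrete valuation ring of characteristic $p$ that is an $A$-algebra, with fraction field $K$ and residue field $k$. Let $\overline K$ be an algebraic closure of $K$ and let $\mathfrak{G}_K=\mathrm{Gal}(K^{sep}/K)=\mathrm{Aut}(\overline K/K)$ be the absolute Galois group. Let $G$ be a connected one-dimensional $p$-divisible group over $R$ with an action of $A$ (a ring homomorphism $A\to \mathrm{End}(G)$) that induces on the cotangent space at the origin the action through $A\to R$; equivalently, $G$ comes from a one-dimensional formal $A$-module over $R$. (For $A=\mathbb{Z}_p$ the action is the canonical one, so that $G$ is then any connected one-dimensional $p$-divisible group over $R$.) For a field $F$ over $R$ say that $G_F$ has formal height $h$ if for every $n$ the identity component of the $p^n$-torsion of $G_F$ has order $\#(A/p^nA)^h$; this is the height of the formal $A$-module over $F$. Suppose that the special fiber $G_k$ has formal height $s$ and the generic fiber $G_K$ has formal height $g$, where $1\le g<s$. Let $T(G)=\varprojlim_n G[\pi^n](\overline K)$, with transition maps multiplication by $\pi$, be the slope $0$ Tate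 module of $G_K$, with the inverse limit topology of discrete groups, and let $\rho^{0/1}\colon \mathfrak{G}_K\to \mathrm{GL}_A(T(G))$ be the action of $\mathfrak{G}_K$ on it. Theorem 6.3. The orbit of every non-zero element of $T(G)$ under the monodromy group $\rho^{0/1}(\mathfrak{G}_K)$ is open in $T(G)$. In particular the representation $\rho^{0/1}$ is irreducible, i.e. $E\otimes_A T(G)$ is non-zero and has no $\mathfrak{G}_K$-stable $E$-subspaces other than $0$ and itself. -/

import Mathlib

open scoped TensorProduct

universe u v w

noncomputable section

/-- The augmentation ideal of a Hopf algebra `B` over `R`: the ideal of the unit section of the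
affine group scheme `Spec B`. -/
abbrev augIdeal (R : Type u) (B : Type v) [CommRing R] [CommRing B] [HopfAlgebra R B] : Ideal B :=
  RingHom.ker (Bialgebra.counitAlgHom R B)

instance augIdeal_isPrime (R : Type u) (B : Type v) [CommRing R] [IsDomain R] [CommRing B]
    [HopfAlgebra R B] : (augIdeal R B).IsPrime :=
  RingHom.ker_isPrime (Bialgebra.counitAlgHom R B)

/-- The comorphism of the multiplication-by-`m` map of the affine group scheme `Spec B`: the `m`-th
power of the identity under convolution. -/
def mulByComorphism (R : Type u) (B : Type v) [CommRing R] [CommRing B] [HopfAlgebra R B]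
    (m : ℕ) : B →ₐ[R] B :=
  ((WithConv.toConv (AlgHom.id R B)) ^ m).ofConv

/-- A `p`-divisible group `G = (G_n, i_n)` over `R` (in the sense of Tate; finite locally free means
finite free, as it does over a local ring): `G_n = Spec (B n)` is a finite free commutative group
scheme over `R` of order `p ^ (n h)`, and `i_n : G_n → G_{n+1}` is a homomorphism such that
`0 → G_n → G_{n+1} → G_{n+1}` is exact, the last map being multiplication by `p ^ n`; that is, `i_n`
is a closed immersion and its ideal is the one generated by the pull-back under `p ^ n` of the
augmentation ideal. -/
structure PDivisibleGroup (p : ℕ) (R : Type u) [CommRing R] where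
  /-- the height `h` -/
  height : ℕ
  /-- the coordinate ring of `G_n` -/
  B : ℕ → Type v
  [commRing : ∀ n, CommRing (B n)]
  [hopf : ∀ n, HopfAlgebra R (B n)]
  [cocomm : ∀ n, Coalgebra.IsCocomm R (B n)]
  [free : ∀ n, Module.Free R (B n)]
  [finite : ∀ n, Module.Finite R (B n)]
  rank_eq : ∀ n, Module.finrank R (B n) = p ^ (n * height)
  /-- the comorphism of `i_n : G_n → G_{n+1}` -/
  res : ∀ n, B (n + 1) →ₐc[R] B n
  res_surjective : ∀ n, Function.Surjective (res n)
  ker_res : ∀ n, RingHom.ker (res n) =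
    (augIdeal R (B (n + 1))).map (mulByComorphism R (B (n + 1)) (p ^ n))

namespace PDivisibleGroup

attribute [instance] commRing hopf cocomm free finite

variable {p : ℕ} {R : Type u} [CommRing R] (G : PDivisibleGroup.{u, v} p R)

/-- `G` is connected: each `G_n` is the spectrum of a local ring (for a base that is a complete local
ring, as in the theorem, this says that each scheme `G_n` is connected). -/
def IsConnected : Prop := ∀ n, IsLocalRing (G.B n)

/-- `G` has dimension `d`: the module `ω_G` of invariant differentials is free of rank `d`. When
`p = 0` in `R`, as in the theorem, `ω_G` is the cotangent module `I_n / I_n ^ 2` of `G_n` at the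
unit section, for every `n ≥ 1`. -/
def HasDimension (d : ℕ) : Prop :=
  ∀ n, 1 ≤ n → Nonempty ((augIdeal R (G.B n)).Cotangent ≃ₗ[R] (Fin d → R))

/-- An action of the ring `A` on the `p`-divisible group `G`, i.e. a ring homomorphism `A → End G`:
`act n a` is the comorphism of the endomorphism `[a]` of `G_n`; addition of endomorphisms is
convolution of comorphisms. -/
class RingAction (A : Type w) [CommRing A] where
  act : ∀ n, A → (G.B n →ₐc[R] G.B n)
  act_one : ∀ n, act n 1 = BialgHom.id R (G.B n)
  act_mul : ∀ n a b, act n (a * b) = (act n b).comp (act n a)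
  act_add : ∀ n a b, WithConv.toConv (act n (a + b)) =
    WithConv.toConv (act n a) * WithConv.toConv (act n b)
  act_res : ∀ n a, (G.res n).comp (act (n + 1) a) = (act n a).comp (G.res n)

/-- The condition `[a](X) = a X + (higher degree terms)` of a formal `A`-module: `A` acts on the
cotangent modules at the unit section through the structure map `A → R`. -/
def IsStrict (A : Type w) [CommRing A] [Algebra A R] [G.RingAction A] : Prop :=
  ∀ n (a : A), ∀ x ∈ augIdeal R (G.B n),
    RingAction.act n a x - algebraMap A R a • x ∈ augIdeal R (G.B n) ^ 2

/-- For a field `F` over `R`: the identity component of `G_F` has height `g` as an `A`-module, that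
is, for every `n` the identity component of the `p ^ n`-torsion has order `#(A / p ^ n A) ^ g`. The
identity component of `Spec (F ⊗ B n)` is the spectrum of the local ring at the origin.
When `A` is the ring of integers of a finite extension of `ℚ_p`, `π` a uniformizer and `G` is
one-dimensional, this says that the identity component of the `π`-torsion has order
`#(A / π A) ^ g`, i.e. that `[π]` is a power series in `T ^ (q ^ g)` but not in `T ^ (q ^ (g+1))`. -/
def HasFormalHeight (A : Type w) [CommRing A] (F : Type*) [Field F] [Algebra R F] (g : ℕ) : Prop :=
  ∀ n, Module.finrank F (Localization.AtPrime (augIdeal F (F ⊗[R] G.B n))) =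
    Nat.card (A ⧸ Ideal.span {(p : A) ^ n}) ^ g

/-- The commutative group `G_n(S)` of `S`-valued points of `G_n`, written additively. -/
def Points (n : ℕ) (S : Type*) [CommRing S] [Algebra R S] : Type _ :=
  Additive (WithConv (G.B n →ₐ[R] S))

section Points

variable {n : ℕ} {S : Type*} [CommRing S] [Algebra R S]

instance : AddCommMonoid (G.Points n S) :=
  inferInstanceAs (AddCommMonoid (Additive (WithConv (G.B n →ₐ[R] S))))

variable {G}

/-- The point given by a ring homomorphism. -/
def Points.mk (f : G.B n →ₐ[R] S) : G.Points n S := Additive.ofMul (WithConv.toConv f)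

/-- The ring homomorphism that a point is. -/
def Points.hom (x : G.Points n S) : G.B n →ₐ[R] S := (Additive.toMul x).ofConv

@[ext] theorem Points.ext {x y : G.Points n S} (h : x.hom = y.hom) : x = y :=
  congrArg (fun f => Additive.ofMul (WithConv.toConv f)) h

@[simp] theorem Points.hom_mk (f : G.B n →ₐ[R] S) : (Points.mk f).hom = f := rfl

theorem Points.mk_add_mk (f g : G.B n →ₐ[R] S) : Points.mk f + Points.mk g =
    Points.mk (WithConv.toConv f * WithConv.toConv g).ofConv := rfl

theorem Points.zero_eq : (0 : G.Points n S) =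
    Points.mk (1 : WithConv (G.B n →ₐ[R] S)).ofConv := rfl

instance : Neg (G.Points n S) :=
  ⟨fun x => Points.mk (x.hom.comp (HopfAlgebra.antipodeAlgHom R (G.B n)))⟩

instance : AddCommGroup (G.Points n S) :=
  { (inferInstance : AddCommMonoid (G.Points n S)) with
    zsmul := zsmulRec
    neg_add_cancel := fun x => by
      have h := congrArg (fun f => x.hom.comp f.ofConv)
        (AlgHom.antipode_id_cancel (R := R) (A := G.B n))
      simp only [AlgHom.comp_convMul_distrib] at h
      refine Points.ext (h.trans ?_)
      ext b
      exact x.hom.commutes _ }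

/-- Pull-back of points along a homomorphism of group schemes, given by its comorphism. -/
def Points.comap {m : ℕ} (h : G.B m →ₐc[R] G.B n) : G.Points n S →+ G.Points m S :=
  AddMonoidHom.mk' (fun x => Points.mk (x.hom.comp (h : G.B m →ₐ[R] G.B n))) fun x y =>
    Points.ext (AlgHom.convMul_comp_bialgHom_distrib
      (WithConv.toConv x.hom) (WithConv.toConv y.hom) h)

/-- Push-forward of points along a homomorphism of `R`-algebras. -/
def Points.push {S' : Type*} [CommRing S'] [Algebra R S'] (f : S →ₐ[R] S') :
    G.Points n S →+ G.Points n S' :=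
  AddMonoidHom.mk' (fun x => Points.mk (f.comp x.hom)) fun x y =>
    Points.ext (AlgHom.comp_convMul_distrib f (WithConv.toConv x.hom) (WithConv.toConv y.hom))

variable {A : Type w} [CommRing A] [G.RingAction A]

theorem Points.comap_act_add (a b : A) (x : G.Points n S) :
    Points.comap (RingAction.act n (a + b)) x =
      Points.comap (RingAction.act n a) x + Points.comap (RingAction.act n b) x := by
  have h : ((RingAction.act n (a + b) : G.B n →ₐc[R] G.B n) : G.B n →ₐ[R] G.B n) =
      (WithConv.toConv ((RingAction.act n a : G.B n →ₐc[R] G.B n) : G.B n →ₐ[R] G.B n) *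
      WithConv.toConv ((RingAction.act n b : G.B n →ₐc[R] G.B n) : G.B n →ₐ[R] G.B n)).ofConv :=
    congrArg (fun f : WithConv (G.B n →ₐc[R] G.B n) => (f.ofConv : G.B n →ₐ[R] G.B n))
      (RingAction.act_add n a b)
  refine Points.ext ?_
  change x.hom.comp _ = _
  rw [h]
  exact AlgHom.comp_convMul_distrib x.hom _ _

/-- The `A`-module structure of `G_n(S)`: `a • x` is the image of `x` under `[a]`. -/
instance : Module A (G.Points n S) where
  smul a x := Points.comap (RingAction.act n a) x
  one_smul x := Points.ext <| AlgHom.ext fun b => by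
    change x.hom (RingAction.act n (1 : A) b) = x.hom b
    rw [RingAction.act_one]; rfl
  mul_smul a b x := Points.ext <| AlgHom.ext fun c => by
    change x.hom (RingAction.act n (a * b) c) =
      x.hom (RingAction.act n b (RingAction.act n a c))
    rw [RingAction.act_mul]; rfl
  smul_zero a := map_zero (Points.comap (RingAction.act n a))
  smul_add a := map_add (Points.comap (RingAction.act n a))
  add_smul a b x := Points.comap_act_add a b x
  zero_smul x := by
    have h := Points.comap_act_add (0 : A) 0 x
    rw [add_zero] at h
    exact left_eq_add.mp h

theorem Points.hom_smul (a : A) (x : G.Points n S) :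
    (a • x).hom = x.hom.comp ((RingAction.act n a : G.B n →ₐc[R] G.B n) : G.B n →ₐ[R] G.B n) := rfl

end Points

section TateModule

variable (A : Type w) [CommRing A] [G.RingAction A] (ϖ : A) (S : Type*) [CommRing S] [Algebra R S]

theorem comap_res_smul (n : ℕ) (a : A) (x : G.Points n S) :
    Points.comap (G.res n) (a • x) = a • Points.comap (G.res n) x :=
  Points.ext <| AlgHom.ext fun b => congrArg x.hom
    (DFunLike.congr_fun (RingAction.act_res n a) b).symm

/-- The Tate module `lim G[ϖ ^ n](S)` of `G` (for a uniformizer `ϖ` of `A`): the sequences of points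
`y n` of `G[ϖ ^ n]` with `ϖ y_{n+1} = y_n`. Here `G[ϖ ^ n]` is the kernel of `ϖ ^ n` on `G_n`
(as `ϖ ^ n` divides `p ^ n`, the `ϖ ^ n`-torsion of `G` lies in `G_n`), and `G_n` is regarded as a
subgroup of `G_{n+1}` through `i_n`. -/
def TateModule : Submodule A (∀ n, G.Points n S) where
  carrier := {y | ∀ n, ϖ ^ n • y n = 0 ∧ Points.comap (G.res n) (y n) = ϖ • y (n + 1)}
  zero_mem' n := by simp
  add_mem' {x y} hx hy n := by simp [hx n, hy n]
  smul_mem' a y hy n := by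
    refine ⟨?_, ?_⟩
    · rw [Pi.smul_apply, smul_comm, (hy n).1, smul_zero]
    · rw [Pi.smul_apply, Pi.smul_apply, G.comap_res_smul, (hy n).2, smul_comm]

/-- The inverse limit topology of the Tate module, each `G_n(S)` being discrete. -/
instance : TopologicalSpace (G.TateModule A ϖ S) :=
  TopologicalSpace.induced (fun y => (y : ∀ n, G.Points n S))
    (@Pi.topologicalSpace ℕ (fun n => G.Points n S) fun _ => ⊥)

variable {S} in
/-- The action of an endomorphism of the `R`-algebra `S` on the Tate module. -/
def TateModule.push (f : S →ₐ[R] S) : G.TateModule A ϖ S →ₗ[A] G.TateModule A ϖ S where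
  toFun y := ⟨fun n => Points.push f (y.1 n), fun n => by
    refine ⟨?_, ?_⟩
    · exact (congrArg (Points.push f) (y.2 n).1).trans (map_zero _)
    · exact congrArg (Points.push f) (y.2 n).2⟩
  map_add' x y := Subtype.ext <| funext fun n => map_add (Points.push f) (x.1 n) (y.1 n)
  map_smul' a x := rfl

end TateModule

section Galois

variable (A : Type w) [CommRing A] [G.RingAction A] (ϖ : A)
variable (K : Type*) [Field K] [Algebra R K]

/-- The slope zero Tate module `T(G) = lim G[ϖ ^ n](K̄)` of the generic fibre, `K̄` an algebraic
closure of `K`. -/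
abbrev slopeZeroTateModule : Type _ := G.TateModule A ϖ (AlgebraicClosure K)

/-- The representation `ρ^{0/1}` of the absolute Galois group `Gal(K^sep/K) = Aut(K̄/K)` on the slope
zero Tate module, through the action on the coordinates of points. -/
def slopeZeroRep : Representation A (AlgebraicClosure K ≃ₐ[K] AlgebraicClosure K)
    (G.slopeZeroTateModule A ϖ K) where
  toFun σ := TateModule.push G A ϖ ((σ : AlgebraicClosure K →ₐ[K] AlgebraicClosure K).restrictScalars R)
  map_one' := rfl
  map_mul' _ _ := rfl

/-- The slope zero monodromy group: the image of `ρ^{0/1}` in `GL(T(G))`. -/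
def monodromyGroup : Subgroup (LinearMap.GeneralLinearGroup A (G.slopeZeroTateModule A ϖ K)) :=
  (G.slopeZeroRep A ϖ K).toHomUnits.range

/-- The representation on `E ⊗ T(G)`, for `E` the fraction field of `A`. -/
def slopeZeroRationalRep (E : Type*) [Field E] [Algebra A E] :
    Representation E (AlgebraicClosure K ≃ₐ[K] AlgebraicClosure K)
      (E ⊗[A] G.slopeZeroTateModule A ϖ K) :=
  (Module.End.baseChangeHom A E (G.slopeZeroTateModule A ϖ K) : _ →* _).comp (G.slopeZeroRep A ϖ K)

end Galois
end PDivisibleGroup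

end

/-! Let `L` be an algebraic closure of `K`, `π` a uniformizer of `R`, c = #(A/pA) and N = c^s. By
Nakayama the augmentation ideal of the coordinate ring of G_n has one generator t, and connectedness
makes t generate the whole ring. So G_n(L) is the root set of one polynomial, of degree c^(sn).
Translations permute its roots transitively, so each has the multiplicity c^(gn) of the origin, and
#G_n(L) = c^((s-g)n).

The main point is that Galois orbits are large. Let w_n in G_n(L) be a non-zero sequence in which
w_n is a unit times p w_{n+1}. Modulo π, multiplication by p pulls t back to a multiple of t^N, so a
valuation V satisfies V(t(w_n)) ≤ max(V(π) V(t(w_{n+1})), V(t(w_{n+1}))^N). Values stay below 1, so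
the first alternative is taken boundedly often (`pow_mul_pow_le_pow_of_le_max`). Hence
V(t(w_n))^(N^n) ≥ V(π)^D for a constant D, and likewise for all conjugates. The product of the roots
of the minimal polynomial of t(w_n) lies in (π) up to sign, so its degree is at least N^n / D
(`le_mul_natDegree_minpoly`). Multiplicities account for a factor of at most c^(gn), so the orbit of
w_n contains at least a fixed proportion of G_n(L) (`exists_pow_le_mul_card_orbit`).

From level n to level n+1 the orbit grows by a factor of at most #G_1(L). A fixed proportion at
every level forces equality from some level on (`eventually_eq_of_pow_le_mul`): the stabilizer of
w_n is then transitive on the points over w_n. By compactness the orbit of a non-zero y contains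
every element agreeing with y at some level, so it is open. It contains a translate y + ϖ^M T(G),
and a stable subspace containing y then contains the whole lattice. -/

noncomputable section

open Polynomial

/-! ### Monogenic algebras over a field. -/

section Monogenic

variable {k S : Type*} [Field k] [CommRing S] [Algebra k S] [Module.Finite k S]

theorem natDegree_minpoly_eq_finrank_of_adjoin_eq_top {τ : S} (hτ : Algebra.adjoin k {τ} = ⊤) :
    (minpoly k τ).natDegree = Module.finrank k S := by
  have hint : IsIntegral k τ := Algebra.IsIntegral.isIntegral τ
  have hs : Function.Surjective (aeval τ : k[X] →ₐ[k] S) := by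
    rw [← AlgHom.range_eq_top, ← Algebra.adjoin_singleton_eq_range_aeval, hτ]
  have hk : (Ideal.span {minpoly k τ} : Ideal k[X]) = RingHom.ker (aeval τ : k[X] →ₐ[k] S) := by
    ext q
    rw [Ideal.mem_span_singleton, RingHom.mem_ker, minpoly.dvd_iff]
  rw [← finrank_quotient_span_eq_natDegree, hk]
  exact (Ideal.quotientKerAlgEquivOfSurjective hs).toLinearEquiv.finrank_eq

/-- Localizing k[X]/(μ), with μ the minimal polynomial of τ, at the point X = f τ keeps only the
primary factor (X - f τ)^m of μ. -/
theorem finrank_localization_ker_eq_rootMultiplicity {τ : S} (hτ : Algebra.adjoin k {τ} = ⊤)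
    (f : S →ₐ[k] k) [(RingHom.ker f).IsPrime] :
    Module.finrank k (Localization.AtPrime (RingHom.ker f)) =
      rootMultiplicity (f τ) (minpoly k τ) := by
  have hint : IsIntegral k τ := Algebra.IsIntegral.isIntegral τ
  have : IsArtinianRing S := IsArtinianRing.of_finite k S
  have hs : Function.Surjective (aeval τ : k[X] →ₐ[k] S) := by
    rw [← AlgHom.range_eq_top, ← Algebra.adjoin_singleton_eq_range_aeval, hτ]
  set L := Localization.AtPrime (RingHom.ker f)
  let Ψ : k[X] →ₐ[k] L := (IsScalarTower.toAlgHom k S L).comp (aeval τ)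
  -- A localization of an Artinian ring is a quotient of it, so it remains to find the kernel.
  have hΨ : Function.Surjective Ψ :=
    (IsArtinianRing.localization_surjective (RingHom.ker f).primeCompl L).comp hs
  have hf (q : k[X]) : f (aeval τ q) = q.eval (f τ) := by
    rw [← aeval_algHom_apply, coe_aeval_eq_eval]
  set m := rootMultiplicity (f τ) (minpoly k τ)
  obtain ⟨H, hH, hHr⟩ := exists_eq_pow_rootMultiplicity_mul_and_not_dvd (minpoly k τ)
    (minpoly.ne_zero hint) (f τ)
  have hk : (Ideal.span {(X - C (f τ)) ^ m} : Ideal k[X]) = RingHom.ker Ψ := by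
    ext q
    rw [Ideal.mem_span_singleton, RingHom.mem_ker]
    change _ ↔ algebraMap S L (aeval τ q) = 0
    rw [IsLocalization.map_eq_zero_iff (RingHom.ker f).primeCompl]
    constructor
    · rintro ⟨q', rfl⟩
      refine ⟨⟨aeval τ H, ?_⟩, ?_⟩
      · intro h
        rw [SetLike.mem_coe, RingHom.mem_ker, hf] at h
        exact hHr (dvd_iff_isRoot.mpr h)
      · change aeval τ H * _ = 0
        rw [← map_mul]
        have : H * ((X - C (f τ)) ^ m * q') = minpoly k τ * q' := by
          rw [← mul_assoc, mul_comm H, ← hH]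
        rw [this, map_mul, minpoly.aeval, zero_mul]
    · rintro ⟨⟨c, hc⟩, h⟩
      obtain ⟨q', rfl⟩ := hs c
      change aeval τ q' * _ = 0 at h
      rw [← map_mul, ← minpoly.dvd_iff] at h
      have hq' : ¬ (X - C (f τ)) ∣ q' := by
        intro hd
        apply hc
        rw [SetLike.mem_coe, RingHom.mem_ker, hf]
        exact dvd_iff_isRoot.mp hd
      have h1 : (X - C (f τ)) ^ m ∣ q' * q := (pow_rootMultiplicity_dvd _ _).trans h
      have hcop : IsCoprime ((X - C (f τ)) ^ m) q' :=
        IsCoprime.pow_left (((irreducible_X_sub_C (f τ)).coprime_iff_not_dvd).mpr hq')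
      exact hcop.dvd_of_dvd_mul_left h1
  rw [← (Ideal.quotientKerAlgEquivOfSurjective hΨ).toLinearEquiv.finrank_eq,
    ← (Ideal.quotientEquivAlgOfEq k hk).toLinearEquiv.finrank_eq,
    finrank_quotient_span_eq_natDegree, natDegree_pow, natDegree_X_sub_C, mul_one]

end Monogenic

/-! ### Conjugates and automorphisms of an algebraically closed field. -/

section Conjugates

variable {K L : Type*} [Field K] [Field L] [Algebra K L] [IsAlgClosed L]

/-- The roots of the minimal polynomial are the conjugates of z. It may be inseparable, but no root
is more multiple in it than in F. -/
theorem natDegree_minpoly_le_mul_ncard_rootSet [Normal K L] (z : L) {F : L[X]} (hF : F ≠ 0) {M : ℕ}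
    (hdvd : (minpoly K z).map (algebraMap K L) ∣ F) (hM : ∀ r, rootMultiplicity r F ≤ M) :
    (minpoly K z).natDegree ≤ (Set.range fun σ : L ≃ₐ[K] L => σ z).ncard * M := by
  classical
  have hint : IsIntegral K z := Normal.isIntegral inferInstance z
  set μ := (minpoly K z).map (algebraMap K L) with hμ
  have hμ0 : μ ≠ 0 := (Polynomial.map_ne_zero_iff (algebraMap K L).injective).mpr
    (minpoly.ne_zero hint)
  have hd : (minpoly K z).natDegree = Multiset.card μ.roots := by
    rw [← (IsAlgClosed.splits μ).natDegree_eq_card_roots, natDegree_map]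
  have hroots : Set.range (fun σ : L ≃ₐ[K] L => σ z) = (μ.roots.toFinset : Set L) := by
    ext r
    rw [Finset.mem_coe, Multiset.mem_toFinset, mem_roots hμ0, hμ, IsRoot, eval_map_algebraMap]
    constructor
    · rintro ⟨σ, rfl⟩
      have := aeval_algHom_apply (σ : L →ₐ[K] L) z (minpoly K z)
      simpa using this
    · intro h
      exact minpoly.exists_algEquiv_of_root' hint.isAlgebraic h
  rw [hroots, Set.ncard_coe_finset, hd, ← Multiset.toFinset_sum_count_eq]
  refine (Finset.sum_le_card_nsmul _ _ M fun r _ => ?_).trans_eq (smul_eq_mul _ _)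
  rw [count_roots]
  exact (rootMultiplicity_le_rootMultiplicity_of_dvd hF hdvd r).trans (hM r)

/-- An automorphism of an algebraic closure is determined by its values on finite sets: if every
finite subfamily of `f` can be moved to `f'`, so can the whole family. -/
theorem exists_algEquiv_of_forall_finset [Algebra.IsAlgebraic K L] {ι : Type*} (f f' : ι → L)
    (h : ∀ s : Finset ι, ∃ σ : L ≃ₐ[K] L, ∀ i ∈ s, σ (f i) = f' i) :
    ∃ σ : L ≃ₐ[K] L, ∀ i, σ (f i) = f' i := by
  let φ : MvPolynomial ι K →ₐ[K] L := MvPolynomial.aeval f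
  let φ' : MvPolynomial ι K →ₐ[K] L := MvPolynomial.aeval f'
  have hker : ∀ q, φ q = 0 → φ' q = 0 := by
    intro q hq
    -- A polynomial relation involves finitely many of the `f i`, so one σ carries it over to the
    -- `f' i`.
    obtain ⟨σ, hσ⟩ := h q.vars
    have : φ' q = σ (φ q) := by
      change _ = (σ : L →ₐ[K] L) (MvPolynomial.aeval f q)
      rw [← AlgHom.comp_apply, MvPolynomial.comp_aeval]
      refine MvPolynomial.eval₂Hom_congr' rfl ?_ rfl
      intro i hi _
      exact (hσ i hi).symm
    rw [this, hq, map_zero]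
  let e := (Ideal.quotientKerAlgEquivOfSurjective φ.rangeRestrict_surjective).symm
  have hk : ∀ a ∈ RingHom.ker φ.rangeRestrict, φ' a = 0 := by
    intro a ha
    apply hker
    have := congrArg Subtype.val (RingHom.mem_ker.mp ha)
    simpa using this
  let ψ : φ.range →ₐ[K] L := (Ideal.Quotient.liftₐ _ φ' hk).comp e.toAlgHom
  have hψ (q) : ψ (φ.rangeRestrict q) = φ' q := by
    have : e (φ.rangeRestrict q) = Ideal.Quotient.mk _ q := by
      rw [AlgEquiv.symm_apply_eq]
      rfl
    change Ideal.Quotient.liftₐ _ φ' hk (e (φ.rangeRestrict q)) = _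
    rw [this]
    rfl
  -- A ring of algebraic elements is a field, so the embedding ψ extends to `L`.
  let N : IntermediateField K L := φ.range.toIntermediateField fun x hx =>
    φ.range.inv_mem_of_algebraic (x := ⟨x, hx⟩) (Algebra.IsAlgebraic.isAlgebraic x)
  obtain ⟨τ, hτ⟩ := IntermediateField.exists_algHom_of_splits (F := K) (E := L) (K := L) (L := N)
    (fun s => ⟨Algebra.IsIntegral.isIntegral s, IsAlgClosed.splits _⟩) ψ
  refine ⟨AlgEquiv.ofBijective τ (Algebra.IsAlgebraic.algHom_bijective τ), fun i => ?_⟩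
  have h1 := hψ (MvPolynomial.X i)
  have h2 := DFunLike.congr_fun hτ (φ.rangeRestrict (MvPolynomial.X i))
  have h3 : φ (MvPolynomial.X i) = f i := MvPolynomial.aeval_X f i
  have h4 : φ' (MvPolynomial.X i) = f' i := MvPolynomial.aeval_X f' i
  rw [← h3, ← h4, ← h1]
  exact h2

end Conjugates

end

noncomputable section

open Polynomial

/-! ### Two growth estimates. -/

section Dynamics

variable {Γ : Type*} [LinearOrderedCommGroupWithZero Γ]

/-- A step with the d-th power does not lower x_j^(d^j). A linear step improves the lower bound ϖ^c
for x_j by a factor ϖ⁻¹, and as x_j < 1 there are at most c of those. -/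
theorem pow_mul_pow_le_pow_of_le_max {ϖ : Γ} (h0 : 0 < ϖ) (h1 : ϖ < 1) {d : ℕ} (hd : d ≠ 0)
    {x : ℕ → Γ} (hx1 : ∀ j, x j < 1) (hx : ∀ j, x j ≤ max (ϖ * x (j + 1)) (x (j + 1) ^ d))
    {c : ℕ} (hc : ϖ ^ c ≤ x 0) (j : ℕ) : ϖ ^ (c * d ^ c) ≤ x j ^ d ^ j := by
  -- Here r counts the linear steps so far; each multiplies the exponent of the first bound by d.
  have key : ∃ r ≤ c, ϖ ^ (c * d ^ r) ≤ x j ^ d ^ j ∧ ϖ ^ (c - r) ≤ x j := by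
    induction j with
    | zero => exact ⟨0, Nat.zero_le _, by simpa using hc, by simpa using hc⟩
    | succ j ih =>
      obtain ⟨r, hr, h2, h3⟩ := ih
      have hmono : x j ≤ x (j + 1) := by
        refine (hx j).trans (max_le ?_ ?_)
        · exact mul_le_of_le_one_left' h1.le
        · exact pow_le_of_le_one zero_le (hx1 _).le hd
      rcases le_max_iff.mp (hx j) with h | h
      · have hrc : r ≠ c := by
          rintro rfl
          rw [Nat.sub_self, pow_zero] at h3
          exact (hx1 j).not_ge h3
        refine ⟨r + 1, by omega, ?_, ?_⟩
        · calc ϖ ^ (c * d ^ (r + 1))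
            _ = (ϖ ^ (c * d ^ r)) ^ d := by rw [← pow_mul, pow_succ, mul_assoc]
            _ ≤ (x j ^ d ^ j) ^ d := pow_le_pow_left' h2 d
            _ = x j ^ d ^ (j + 1) := by rw [← pow_mul, pow_succ]
            _ ≤ x (j + 1) ^ d ^ (j + 1) := pow_le_pow_left' hmono _
        · have : ϖ * ϖ ^ (c - (r + 1)) ≤ ϖ * x (j + 1) := by
            rw [← pow_succ', show c - (r + 1) + 1 = c - r by omega]
            exact h3.trans h
          exact le_of_mul_le_mul_left this h0
      · refine ⟨r, hr, ?_, h3.trans hmono⟩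
        calc ϖ ^ (c * d ^ r) ≤ x j ^ d ^ j := h2
          _ ≤ (x (j + 1) ^ d) ^ d ^ j := pow_le_pow_left' h _
          _ = x (j + 1) ^ d ^ (j + 1) := by rw [← pow_mul, pow_succ']
  obtain ⟨r, hr, h2, -⟩ := key
  refine le_trans ?_ h2
  exact pow_le_pow_right_of_le_one' h1.le
    (Nat.mul_le_mul_left c (Nat.pow_le_pow_right (Nat.pos_of_ne_zero hd) hr))

end Dynamics

/-- The ratio a_n / Q^n is non-increasing and bounded below by 1/C eventually, so it has a limit l >
0. A step with F_n < Q shrinks it by at least 1 - 1/Q, which would take it below l once it is less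
than l (1 + 1/Q). -/
theorem eventually_eq_of_pow_le_mul {a F : ℕ → ℕ} {Q C : ℕ}
    (hQ : 0 < Q) (hmul : ∀ n, a (n + 1) = F n * a n) (hF : ∀ n, F n ≤ Q) {n₀ : ℕ}
    (hC : ∀ n, n₀ ≤ n → Q ^ n ≤ C * a n) : ∃ N, ∀ n, N ≤ n → F n = Q := by
  have hQ' : (0 : ℝ) < Q := by exact_mod_cast hQ
  let b : ℕ → ℝ := fun n => a n / (Q : ℝ) ^ n
  have hanti : Antitone b := by
    refine antitone_nat_of_succ_le fun n => ?_
    simp only [b]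
    rw [div_le_div_iff₀ (by positivity) (by positivity), hmul, pow_succ]
    have : (F n : ℝ) ≤ Q := by exact_mod_cast hF n
    push_cast
    have h2 : (0 : ℝ) ≤ a n * (Q : ℝ) ^ n := by positivity
    nlinarith
  have hC0 : (0 : ℝ) < C := by
    have h1 := hC n₀ le_rfl
    have : 0 < C := Nat.pos_of_ne_zero fun h => by
      rw [h, zero_mul] at h1
      exact absurd h1 (Nat.not_le.mpr (pow_pos hQ _))
    exact_mod_cast this
  have hlow : ∀ n, 1 / (C : ℝ) ≤ b n := by
    intro n
    refine le_trans ?_ (hanti (le_max_left n n₀))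
    simp only [b]
    rw [div_le_div_iff₀ hC0 (by positivity), one_mul]
    have := hC _ (le_max_right n n₀)
    calc ((Q : ℝ) ^ (max n n₀)) ≤ C * a (max n n₀) := by exact_mod_cast this
      _ = _ := mul_comm _ _
  have hbdd : BddBelow (Set.range b) := ⟨1 / C, by rintro _ ⟨n, rfl⟩; exact hlow n⟩
  have hlim := tendsto_atTop_ciInf hanti hbdd
  set l := ⨅ n, b n
  have hl : 1 / (C : ℝ) ≤ l := le_ciInf hlow
  have hl0 : 0 < l := lt_of_lt_of_le (by positivity) hl
  have hev : ∀ᶠ n in Filter.atTop, b n < l * (1 + 1 / Q) := by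
    refine hlim.eventually_lt_const ?_
    have : (0 : ℝ) < 1 / Q := by positivity
    nlinarith
  obtain ⟨N, hN⟩ := Filter.eventually_atTop.mp hev
  refine ⟨N, fun n hn => le_antisymm (hF n) ?_⟩
  by_contra! hlt
  have h1 : (F n : ℝ) + 1 ≤ Q := by exact_mod_cast hlt
  have h2 : b (n + 1) = F n / Q * b n := by
    simp only [b, hmul, pow_succ]
    push_cast
    field_simp
  have h3 : l ≤ b (n + 1) := ciInf_le hbdd _
  have h4 := hN n hn
  have h5 : (F n : ℝ) / Q ≤ 1 - 1 / Q := by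
    rw [div_le_iff₀ hQ']
    field_simp
    linarith
  have h6 : (0 : ℝ) ≤ F n / Q := by positivity
  have h7 : (F n : ℝ) / Q * b n ≤ (1 - 1 / Q) * (l * (1 + 1 / Q)) :=
    mul_le_mul h5 h4.le (le_trans (by positivity) (hlow n)) (h6.trans h5)
  have h8 : (1 - 1 / (Q : ℝ)) * (l * (1 + 1 / Q)) = l - l * (1 / Q) ^ 2 := by ring
  have h9 : 0 < l * (1 / (Q : ℝ)) ^ 2 := by positivity
  linarith

/-! ### Valuations, norms and degrees. -/

section Valuation

variable {R : Type*} [CommRing R] [IsDomain R] [IsDiscreteValuationRing R]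
variable {K L : Type*} [Field K] [Field L] [Algebra R K] [IsFractionRing R K] [Algebra K L]
  [Algebra R L] [IsScalarTower R K L]

/-- This valuation is not claimed to be Galois invariant; later bounds are therefore proved for all
conjugates. -/
theorem exists_valuationSubring_of_isLocalRing (R L : Type*) [CommRing R] [IsLocalRing R] [Field L]
    [Algebra R L] :
    ∃ V : ValuationSubring L, (∀ r : R, V.valuation (algebraMap R L r) ≤ 1) ∧
      ∀ r ∈ IsLocalRing.maximalIdeal R, V.valuation (algebraMap R L r) < 1 := by
  obtain ⟨V, hV, h⟩ := IsLocalRing.exists_factor_valuationRing (algebraMap R L)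
  refine ⟨V, fun r => (V.valuation_le_one_iff _).mpr (hV r), fun r hr => ?_⟩
  refine (V.valuation_lt_one_iff ⟨_, hV r⟩).mp ?_
  rw [IsLocalRing.mem_maximalIdeal] at hr ⊢
  exact fun hu => hr (h.map_nonunit r hu)

variable {Γ : Type*} [LinearOrderedCommGroupWithZero Γ] (V : Valuation L Γ)

omit [IsDomain R] [IsDiscreteValuationRing R] in
theorem Valuation.le_one_of_isIntegral (hV : ∀ r : R, V (algebraMap R L r) ≤ 1) {z : L}
    (hz : IsIntegral R z) : V z ≤ 1 := by
  let _ : Algebra R V.integer := ((algebraMap R L).codRestrict V.integer hV).toAlgebra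
  have : IsScalarTower R V.integer L := IsScalarTower.of_algebraMap_eq fun _ => rfl
  exact (Valuation.integer.integers V).mem_of_integral (hz.tower_top (A := V.integer))

omit [IsDomain R] [IsDiscreteValuationRing R] in
theorem Valuation.algebraMap_eq_one_of_isUnit (hV : ∀ r : R, V (algebraMap R L r) ≤ 1) {r : R}
    (hr : IsUnit r) : V (algebraMap R L r) = 1 := by
  obtain ⟨r', hr'⟩ := hr.exists_right_inv
  refine le_antisymm (hV r) ?_
  have h : V (algebraMap R L r) * V (algebraMap R L r') = 1 := by
    rw [← map_mul, ← map_mul, hr', map_one, map_one]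
  rw [← h]
  exact mul_le_of_le_one_right' (hV r')

theorem Valuation.map_multiset_prod_lt_one {s : Multiset L} (hs : s ≠ 0) (h : ∀ r ∈ s, V r < 1) :
    V s.prod < 1 := by
  induction s using Multiset.induction_on with
  | empty => exact absurd rfl hs
  | cons a s ih =>
    rw [Multiset.prod_cons, map_mul]
    have ha := h a (Multiset.mem_cons_self a s)
    rcases eq_or_ne s 0 with rfl | h0
    · simpa using ha
    · have := ih h0 fun r hr => h r (Multiset.mem_cons_of_mem hr)
      exact (mul_le_of_le_one_right' this.le).trans_lt ha

theorem Valuation.pow_card_le_map_multiset_prod_pow {s : Multiset L} {γ : Γ} {e : ℕ}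
    (h : ∀ r ∈ s, γ ≤ V r ^ e) : γ ^ Multiset.card s ≤ V s.prod ^ e := by
  induction s using Multiset.induction_on with
  | empty => simp
  | cons a s ih =>
    rw [Multiset.prod_cons, map_mul, Multiset.card_cons, pow_succ', mul_pow]
    exact mul_le_mul' (h a (Multiset.mem_cons_self a s))
      (ih fun r hr => h r (Multiset.mem_cons_of_mem hr))

/-- The product of the roots is, up to sign, the constant term of the minimal polynomial. That term
lies in R, which is integrally closed, and in (π), as the roots have value < 1. Roots that are all
close to the unit circle must then be numerous. -/
theorem le_mul_natDegree_minpoly [IsAlgClosed L] (hV : ∀ r : R, V (algebraMap R L r) ≤ 1) {π : R}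
    (hπ : Irreducible π) (hVπ : V (algebraMap R L π) < 1) {z : L} (hz : IsIntegral R z) {D e : ℕ}
    (hr1 : ∀ r : L, aeval r (minpoly K z) = 0 → V r < 1)
    (hr : ∀ r : L, aeval r (minpoly K z) = 0 → V (algebraMap R L π) ^ D ≤ V r ^ e) :
    e ≤ D * (minpoly K z).natDegree := by
  have hinj : Function.Injective (algebraMap R L) := by
    rw [IsScalarTower.algebraMap_eq R K L]
    exact (algebraMap K L).injective.comp (IsFractionRing.injective R K)
  have hμR : minpoly K z = (minpoly R z).map (algebraMap R K) :=
    minpoly.isIntegrallyClosed_eq_field_fractions' K hz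
  have hzK : IsIntegral K z := hz.tower_top
  set μ := (minpoly K z).map (algebraMap K L) with hμ
  have hmonic : μ.Monic := (minpoly.monic hzK).map _
  have hd : Multiset.card μ.roots = (minpoly K z).natDegree := by
    rw [← (IsAlgClosed.splits μ).natDegree_eq_card_roots, natDegree_map]
  set c := (minpoly R z).coeff 0
  have hc : V (algebraMap R L c) = V μ.roots.prod := by
    have h1 : algebraMap R L c = μ.coeff 0 := by
      rw [hμ, hμR, coeff_map, coeff_map, ← IsScalarTower.algebraMap_apply]
    rw [h1, (IsAlgClosed.splits μ).coeff_zero_eq_prod_roots_of_monic hmonic, map_mul, map_pow,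
      Valuation.map_neg, map_one, one_pow, one_mul]
  have hroot : ∀ r ∈ μ.roots, aeval r (minpoly K z) = 0 := by
    intro r h
    rw [mem_roots hmonic.ne_zero, hμ, IsRoot, eval_map_algebraMap] at h
    exact h
  have hlt : V μ.roots.prod < 1 := by
    have h0 : μ.roots ≠ 0 := by
      intro h
      rw [h, Multiset.card_zero] at hd
      exact (minpoly.natDegree_pos hzK).ne hd
    exact V.map_multiset_prod_lt_one h0 fun r h => hr1 r (hroot r h)
  have hcπ : π ∣ c := by
    have : c ∈ IsLocalRing.maximalIdeal R := by
      rw [IsLocalRing.mem_maximalIdeal]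
      intro hu
      rw [← hc, V.algebraMap_eq_one_of_isUnit hV hu] at hlt
      exact lt_irrefl _ hlt
    rwa [hπ.maximalIdeal_eq, Ideal.mem_span_singleton] at this
  obtain ⟨c', hc'⟩ := hcπ
  have hle : V (algebraMap R L c) ≤ V (algebraMap R L π) := by
    rw [hc', map_mul, map_mul]
    exact mul_le_of_le_one_right' (hV c')
  have hπ0 : 0 < V (algebraMap R L π) := by
    rw [Valuation.pos_iff]
    exact (map_ne_zero_iff _ hinj).mpr hπ.ne_zero
  have hfin : V (algebraMap R L π) ^ (D * (minpoly K z).natDegree) ≤ V (algebraMap R L π) ^ e := by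
    rw [pow_mul, ← hd]
    refine (V.pow_card_le_map_multiset_prod_pow fun r h => hr r (hroot r h)).trans ?_
    rw [← hc]
    exact pow_le_pow_left' hle e
  by_contra! hlt'
  exact (pow_lt_pow_right_of_lt_one₀ hπ0 hVπ hlt').not_ge hfin

end Valuation

end

noncomputable section

open IsLocalRing

/-! ### The augmentation ideal is principal. -/

section AugIdeal

variable {R B : Type*} [CommRing R] [CommRing B] [HopfAlgebra R B]

theorem mem_augIdeal {b : B} : b ∈ augIdeal R B ↔ Coalgebra.counit (R := R) b = 0 := Iff.rfl

theorem sub_algebraMap_counit_mem_augIdeal (b : B) :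
    b - algebraMap R B (Coalgebra.counit (R := R) b) ∈ augIdeal R B := by
  rw [mem_augIdeal, map_sub, Bialgebra.counit_algebraMap, sub_self]

theorem exists_eq_algebraMap_counit_add {t : B} (ht : augIdeal R B = Ideal.span {t}) (b : B) :
    ∃ b', b = algebraMap R B (Coalgebra.counit (R := R) b) + t * b' := by
  have h := sub_algebraMap_counit_mem_augIdeal (R := R) b
  rw [ht, Ideal.mem_span_singleton] at h
  obtain ⟨b', hb'⟩ := h
  exact ⟨b', by rw [← hb', add_sub_cancel]⟩

theorem counit_eq_zero_of_generator {t : B} (ht : augIdeal R B = Ideal.span {t}) :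
    Coalgebra.counit (R := R) t = 0 := by
  rw [← mem_augIdeal, ht]
  exact Ideal.mem_span_singleton_self t

theorem counitAlgHom_surjective : Function.Surjective (Bialgebra.counitAlgHom R B) :=
  fun r => ⟨algebraMap R B r, Bialgebra.counit_algebraMap r⟩

/-- This serves level 0, about which `HasDimension` says nothing. -/
theorem exists_augIdeal_eq_span_of_finrank_eq_one [IsDomain R] [Module.Free R B]
    [Module.Finite R B] (h : Module.finrank R B = 1) : augIdeal R B = Ideal.span {0} := by
  have e : B ≃ₗ[R] R := LinearEquiv.ofFinrankEq B R (by rw [h, Module.finrank_self])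
  have hs : Function.Surjective
      ((Bialgebra.counitAlgHom R B).toLinearMap ∘ₗ e.symm.toLinearMap) :=
    counitAlgHom_surjective.comp e.symm.surjective
  have hi := OrzechProperty.injective_of_surjective_endomorphism _ hs
  rw [Ideal.span_singleton_eq_bot.mpr rfl, eq_bot_iff]
  intro b hb
  have : e b = 0 := hi (by simpa using hb)
  simpa using this

/-- Nakayama: a lift t of a basis vector of I/I² satisfies I ≤ (t) + I·I. -/
theorem exists_augIdeal_eq_span_of_cotangent [IsNoetherianRing R] [IsLocalRing R]
    [Module.Finite R B] [IsLocalRing B]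
    (h : Nonempty ((augIdeal R B).Cotangent ≃ₗ[R] (Fin 1 → R))) :
    ∃ t, augIdeal R B = Ideal.span {t} := by
  obtain ⟨e⟩ := h
  have : IsNoetherianRing B := IsNoetherianRing.of_finite R B
  obtain ⟨⟨t, htI⟩, ht⟩ := (augIdeal R B).toCotangent_surjective (e.symm 1)
  refine ⟨t, le_antisymm ?_ ((Ideal.span_singleton_le_iff_mem _).mpr htI)⟩
  have hne : augIdeal R B ≠ ⊤ := RingHom.ker_ne_top _
  refine Submodule.le_of_le_smul_of_le_jacobson_bot (I := augIdeal R B) (IsNoetherian.noetherian _)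
    ((IsLocalRing.le_maximalIdeal hne).trans (IsLocalRing.maximalIdeal_le_jacobson _)) ?_
  intro b hb
  obtain ⟨r, hr⟩ : ∃ r : R, (augIdeal R B).toCotangent ⟨b, hb⟩ =
      (augIdeal R B).toCotangent (r • ⟨t, htI⟩) := by
    refine ⟨e ((augIdeal R B).toCotangent ⟨b, hb⟩) 0, e.injective ?_⟩
    have : (augIdeal R B).toCotangent ((e ((augIdeal R B).toCotangent ⟨b, hb⟩) 0) •
        (⟨t, htI⟩ : augIdeal R B)) = (e ((augIdeal R B).toCotangent ⟨b, hb⟩) 0) • e.symm 1 := by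
      rw [← ht]
      rfl
    rw [this, map_smul, LinearEquiv.apply_symm_apply]
    ext i
    rw [Subsingleton.elim i 0]
    simp
  rw [Ideal.toCotangent_eq] at hr
  have h1 : b = r • t + (b - r • t) := by ring
  rw [h1]
  refine Submodule.add_mem_sup ?_ ?_
  · rw [Algebra.smul_def]
    exact Ideal.mul_mem_left _ _ (Ideal.mem_span_singleton_self t)
  · rw [smul_eq_mul, ← pow_two]
    exact hr

end AugIdeal

/-! ### Expansion in powers of the coordinate. -/

section Generator

variable {R B : Type*} [CommRing R] [IsLocalRing R] [CommRing B] [HopfAlgebra R B]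
  [Module.Finite R B] [IsLocalRing B]

omit [Module.Finite R B] in
theorem augIdeal_le_maximalIdeal : augIdeal R B ≤ maximalIdeal B :=
  le_maximalIdeal (RingHom.ker_ne_top _)

/-- By integrality every prime of B above the maximal ideal of R is maximal, hence is the maximal
ideal of B. -/
theorem exists_pow_mem_map_maximalIdeal {b : B} (hb : b ∈ maximalIdeal B) :
    ∃ j, b ^ j ∈ (maximalIdeal R).map (algebraMap R B) := by
  have : b ∈ ((maximalIdeal R).map (algebraMap R B)).radical := by
    rw [Ideal.radical_eq_sInf, Ideal.mem_sInf]
    rintro P ⟨hP, hPp⟩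
    have hc : P.comap (algebraMap R B) = maximalIdeal R := by
      refine (eq_maximalIdeal ?_)
      have h1 : maximalIdeal R ≤ P.comap (algebraMap R B) := Ideal.map_le_iff_le_comap.mp hP
      have h2 : P.comap (algebraMap R B) ≠ ⊤ := Ideal.comap_ne_top _ hPp.ne_top
      rw [← (maximalIdeal.isMaximal R).eq_of_le h2 h1]
      infer_instance
    have : (P.comap (algebraMap R B)).IsMaximal := hc ▸ maximalIdeal.isMaximal R
    have := Ideal.isMaximal_of_isIntegral_of_isMaximal_comap P this
    rw [eq_maximalIdeal this]
    exact hb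
  exact this

variable {t : B} (ht : augIdeal R B = Ideal.span {t})
include ht

omit [IsLocalRing R] [Module.Finite R B] [IsLocalRing B] in
-- Taylor expansion: the counit supplies the constant term, and the rest is divisible by t.
theorem exists_mem_span_pow_add (j : ℕ) (b : B) :
    ∃ s ∈ Submodule.span R (Set.range fun i : Fin j => t ^ (i : ℕ)), ∃ b', b = s + t ^ j * b' := by
  induction j with
  | zero => exact ⟨0, zero_mem _, b, by simp⟩
  | succ j ih =>
    obtain ⟨s, hs, b', rfl⟩ := ih
    obtain ⟨b'', h⟩ := exists_eq_algebraMap_counit_add ht b'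
    refine ⟨s + (Coalgebra.counit (R := R) b') • t ^ j, add_mem ?_ ?_, b'', ?_⟩
    · refine Submodule.span_mono ?_ hs
      rintro _ ⟨i, rfl⟩
      exact ⟨i.castSucc, rfl⟩
    · exact Submodule.smul_mem _ _ (Submodule.subset_span ⟨Fin.last j, rfl⟩)
    · rw [Algebra.smul_def]
      nth_rewrite 1 [h]
      ring

omit [IsLocalRing B] in
theorem span_pow_eq_top {j : ℕ} (hj : t ^ j ∈ (maximalIdeal R).map (algebraMap R B)) :
    Submodule.span R (Set.range fun i : Fin j => t ^ (i : ℕ)) = ⊤ := by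
  rw [eq_top_iff]
  refine Submodule.le_of_le_smul_of_le_jacobson_bot (I := maximalIdeal R) Module.Finite.fg_top
    (maximalIdeal_le_jacobson _) ?_
  rintro b -
  obtain ⟨s, hs, b', rfl⟩ := exists_mem_span_pow_add ht j b
  refine Submodule.add_mem_sup hs ?_
  rw [Ideal.smul_top_eq_map]
  exact Ideal.mul_mem_right _ _ hj

omit [Module.Finite R B] in
theorem generator_mem_maximalIdeal : t ∈ maximalIdeal B :=
  augIdeal_le_maximalIdeal (R := R) (ht ▸ Ideal.mem_span_singleton_self t)

theorem adjoin_generator_eq_top : Algebra.adjoin R {t} = ⊤ := by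
  obtain ⟨j, hj⟩ := exists_pow_mem_map_maximalIdeal (R := R) (generator_mem_maximalIdeal ht)
  rw [← Algebra.toSubmodule_eq_top, eq_top_iff, ← span_pow_eq_top ht hj, Submodule.span_le]
  rintro _ ⟨i, rfl⟩
  exact pow_mem (Algebra.self_mem_adjoin_singleton R t) _

omit [IsLocalRing B] in
theorem finrank_le_of_pow_mem [IsDomain R] [Module.Free R B] {j : ℕ}
    (hj : t ^ j ∈ (maximalIdeal R).map (algebraMap R B)) : Module.finrank R B ≤ j := by
  have h := finrank_range_le_card (R := R) (fun i : Fin j => t ^ (i : ℕ))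
  rw [Set.finrank, span_pow_eq_top ht hj, finrank_top, Fintype.card_fin] at h
  exact h

omit [Module.Finite R B] in
-- The order of vanishing on the closed fibre: the first Taylor coefficient that is a unit makes the
-- whole cofactor a unit.
theorem mem_sup_span_pow_or_exists (b : B) (j : ℕ) :
    b ∈ (maximalIdeal R).map (algebraMap R B) ⊔ Ideal.span {t ^ j} ∨
      ∃ i < j, ∃ u, IsUnit u ∧ b - u * t ^ i ∈ (maximalIdeal R).map (algebraMap R B) := by
  induction j with
  | zero => left; simp
  | succ j ih =>
    rcases ih with h | ⟨i, hi, h⟩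
    · obtain ⟨a, ha, c, hc, rfl⟩ := Submodule.mem_sup.mp h
      obtain ⟨b', rfl⟩ := Ideal.mem_span_singleton.mp hc
      obtain ⟨b'', hb''⟩ := exists_eq_algebraMap_counit_add ht b'
      by_cases hu : IsUnit (Coalgebra.counit (R := R) b')
      · refine Or.inr ⟨j, j.lt_succ_self, b', ?_, ?_⟩
        · by_contra hn
          have h1 : b' ∈ maximalIdeal B := hn
          have h2 : algebraMap R B (Coalgebra.counit (R := R) b') ∈ maximalIdeal B := by
            rw [eq_sub_of_add_eq hb''.symm]
            exact sub_mem h1 (Ideal.mul_mem_right _ _ (generator_mem_maximalIdeal ht))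
          exact h2 (hu.map _)
        · convert ha using 1
          ring
      · left
        have h1 : Coalgebra.counit (R := R) b' ∈ maximalIdeal R := hu
        rw [hb'', mul_add, ← add_assoc, ← mul_assoc, ← pow_succ]
        refine Submodule.add_mem_sup (add_mem ha ?_) ?_
        · exact Ideal.mul_mem_left _ _ (Ideal.mem_map_of_mem _ h1)
        · exact Ideal.mul_mem_right _ _ (Ideal.mem_span_singleton_self _)
    · exact Or.inr ⟨i, hi.trans j.lt_succ_self, h⟩

omit [Module.Finite R B] in
-- If b vanished on the closed fibre to an order i below the rank of B', then `f t ^ i` would vanish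
-- on the closed fibre of B', and i powers of `f t` would span B'.
theorem mem_sup_span_pow_finrank {B' : Type*} [IsDomain R] [CommRing B'] [HopfAlgebra R B']
    [Module.Finite R B'] [Module.Free R B'] [IsLocalRing B'] (f : B →ₐ[R] B')
    (hf : augIdeal R B' = Ideal.span {f t}) {b : B} (hb : f b = 0) :
    b ∈ (maximalIdeal R).map (algebraMap R B) ⊔ Ideal.span {t ^ Module.finrank R B'} := by
  rcases mem_sup_span_pow_or_exists ht b (Module.finrank R B') with h | ⟨i, hi, u, hu, h⟩
  · exact h
  · exfalso
    have h1 := Ideal.mem_map_of_mem f.toRingHom h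
    rw [Ideal.map_map, show f.toRingHom.comp (algebraMap R B) = algebraMap R B' from
      f.comp_algebraMap] at h1
    change f (b - u * t ^ i) ∈ _ at h1
    rw [map_sub, map_mul, map_pow, hb, zero_sub, neg_mem_iff,
      Ideal.unit_mul_mem_iff_mem _ (hu.map f)] at h1
    exact (finrank_le_of_pow_mem hf h1).not_gt hi

omit [Module.Finite R B] [IsLocalRing B] in
-- The counit kills b and t^d, hence also the cofactor of π, which is therefore divisible by t. The
-- valuation estimate needs this extra factor t.
theorem exists_eq_of_mem_augIdeal [IsDomain R] [Module.Free R B] {π : R} (hπ : π ≠ 0)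
    (hm : maximalIdeal R = Ideal.span {π}) {b : B}
    (hb : b ∈ augIdeal R B) {d : ℕ} (hd : d ≠ 0)
    (h : b ∈ (maximalIdeal R).map (algebraMap R B) ⊔ Ideal.span {t ^ d}) :
    ∃ b₁ b₂, b = algebraMap R B π * (t * b₁) + t ^ d * b₂ := by
  obtain ⟨a, ha, c, hc, rfl⟩ := Submodule.mem_sup.mp h
  obtain ⟨b₂, rfl⟩ := Ideal.mem_span_singleton.mp hc
  rw [hm, Ideal.map_span, Set.image_singleton, Ideal.mem_span_singleton] at ha
  obtain ⟨a', rfl⟩ := ha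
  have h1 : Coalgebra.counit (R := R) a' = 0 := by
    rw [mem_augIdeal, map_add, ← Algebra.smul_def, map_smul, Bialgebra.counit_mul,
      Bialgebra.counit_pow, counit_eq_zero_of_generator ht, zero_pow hd, zero_mul, add_zero,
      smul_eq_mul] at hb
    exact (mul_eq_zero.mp hb).resolve_left hπ
  rw [← mem_augIdeal, ht, Ideal.mem_span_singleton] at h1
  obtain ⟨b₁, rfl⟩ := h1
  exact ⟨b₁, b₂, rfl⟩

end Generator

end

noncomputable section

open Polynomial WithConv

/-! ### Translations of a group scheme. -/

section Translation

variable {R B L : Type*} [CommRing R] [CommRing B] [HopfAlgebra R B] [CommRing L] [Algebra R L]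

/-- The `L`-algebra homomorphism `L ⊗ B → S` extending an `R`-algebra homomorphism `B → S`. -/
abbrev extendScalarsHom {S : Type*} [CommRing S] [Algebra R S] [Algebra L S] [IsScalarTower R L S]
    (f : B →ₐ[R] S) : L ⊗[R] B →ₐ[L] S :=
  Algebra.TensorProduct.lift (Algebra.ofId L S) f fun _ _ => .all _ _

theorem algHom_tensor_ext {S : Type*} [CommRing S] [Algebra R S] [Algebra L S] [IsScalarTower R L S]
    {f g : L ⊗[R] B →ₐ[L] S} (h : ∀ b : B, f (1 ⊗ₜ b) = g (1 ⊗ₜ b)) : f = g := by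
  ext b
  exact h b

/-- The comorphism of the translation by the point `x` on the base change of the group scheme
`Spec B` to `L`. -/
def translation (x : WithConv (B →ₐ[R] L)) : L ⊗[R] B →ₐ[L] L ⊗[R] B :=
  extendScalarsHom (toConv (((Algebra.ofId L (L ⊗[R] B)).restrictScalars R).comp x.ofConv) *
    toConv (Algebra.TensorProduct.includeRight : B →ₐ[R] L ⊗[R] B)).ofConv

theorem translation_comp_includeRight (x : WithConv (B →ₐ[R] L)) :
    ((translation x).restrictScalars R).comp Algebra.TensorProduct.includeRight =
      (toConv (((Algebra.ofId L (L ⊗[R] B)).restrictScalars R).comp x.ofConv) *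
        toConv (Algebra.TensorProduct.includeRight : B →ₐ[R] L ⊗[R] B)).ofConv :=
  Algebra.TensorProduct.lift_comp_includeRight _ _ fun _ _ => .all _ _

theorem translation_comp (x y : WithConv (B →ₐ[R] L)) :
    (translation x).comp (translation y) = translation (y * x) := by
  have h : ((translation x).restrictScalars R).comp
      (((translation y).restrictScalars R).comp Algebra.TensorProduct.includeRight) =
      ((translation (y * x)).restrictScalars R).comp Algebra.TensorProduct.includeRight := by
    rw [translation_comp_includeRight, translation_comp_includeRight, AlgHom.comp_convMul_distrib]
    simp only
    rw [translation_comp_includeRight, AlgHom.comp_convMul_distrib, ofConv_toConv, toConv_ofConv,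
      ← mul_assoc]
    have : ((translation x).restrictScalars R).comp
        (((Algebra.ofId L (L ⊗[R] B)).restrictScalars R).comp y.ofConv) =
        ((Algebra.ofId L (L ⊗[R] B)).restrictScalars R).comp y.ofConv := by
      ext b
      exact (translation x).commutes _
    rw [this]
  exact algHom_tensor_ext fun b => DFunLike.congr_fun h b

theorem translation_one : translation (1 : WithConv (B →ₐ[R] L)) = AlgHom.id L _ := by
  have h : ((Algebra.ofId L (L ⊗[R] B)).restrictScalars R).comp
      (1 : WithConv (B →ₐ[R] L)).ofConv = (1 : WithConv (B →ₐ[R] L ⊗[R] B)).ofConv := by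
    ext b
    exact (IsScalarTower.algebraMap_apply R L (L ⊗[R] B) _).symm
  refine algHom_tensor_ext fun b => ?_
  refine (DFunLike.congr_fun (translation_comp_includeRight _) b).trans ?_
  rw [h, toConv_ofConv, one_mul]
  rfl

theorem counit_translation (x : WithConv (B →ₐ[R] L)) (b : B) :
    Bialgebra.counitAlgHom L (L ⊗[R] B) (translation x (1 ⊗ₜ b)) = x.ofConv b := by
  have h : ((Bialgebra.counitAlgHom L (L ⊗[R] B)).restrictScalars R).comp
      (((translation x).restrictScalars R).comp Algebra.TensorProduct.includeRight) = x.ofConv := by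
    rw [translation_comp_includeRight, AlgHom.comp_convMul_distrib]
    have h1 : ((Bialgebra.counitAlgHom L (L ⊗[R] B)).restrictScalars R).comp
        (((Algebra.ofId L (L ⊗[R] B)).restrictScalars R).comp x.ofConv) = x.ofConv := by
      ext b
      exact (Bialgebra.counitAlgHom L (L ⊗[R] B)).commutes _
    simp only
    rw [h1, Bialgebra.counitAlgHom_comp_includeRight]
    exact congrArg ofConv (mul_one x)
  exact DFunLike.congr_fun h b

theorem exists_mul_eq_one (x : WithConv (B →ₐ[R] L)) : ∃ y, y * x = 1 := by
  refine ⟨toConv (x.ofConv.comp (HopfAlgebra.antipodeAlgHom R B)), ?_⟩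
  have h := congrArg (fun f => x.ofConv.comp f.ofConv)
    (AlgHom.antipode_id_cancel (R := R) (A := B))
  simp only [AlgHom.comp_convMul_distrib] at h
  refine WithConv.ofConv_injective (h.trans ?_)
  ext b
  exact x.ofConv.commutes _

theorem translation_bijective [Coalgebra.IsCocomm R B] (x : WithConv (B →ₐ[R] L)) :
    Function.Bijective (translation x) := by
  obtain ⟨y, hy⟩ := exists_mul_eq_one x
  have h1 := translation_comp x y
  have h2 := translation_comp y x
  rw [hy, translation_one] at h1
  rw [mul_comm, hy, translation_one] at h2
  exact ⟨Function.LeftInverse.injective (DFunLike.congr_fun h2),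
    Function.RightInverse.surjective (DFunLike.congr_fun h1)⟩

end Translation

/-! ### Points as roots, and their common multiplicity. -/

section RootMultiplicity

variable {R B : Type*} [CommRing R] [CommRing B] [HopfAlgebra R B]

theorem adjoin_one_tmul_eq_top (L : Type*) [CommRing L] [Algebra R L] {t : B}
    (ht : Algebra.adjoin R {t} = ⊤) : Algebra.adjoin L {(1 : L) ⊗ₜ[R] t} = ⊤ := by
  rw [eq_top_iff]
  rintro z -
  induction z with
  | zero => exact zero_mem _
  | add a b ha hb => exact add_mem ha hb
  | tmul a b =>
    have hb : b ∈ Algebra.adjoin R {t} := ht ▸ Algebra.mem_top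
    have h : (1 : L) ⊗ₜ[R] b ∈ Algebra.adjoin L {(1 : L) ⊗ₜ[R] t} := by
      induction hb using Algebra.adjoin_induction with
      | mem x hx =>
        rw [Set.mem_singleton_iff.mp hx]
        exact Algebra.self_mem_adjoin_singleton L _
      | algebraMap r =>
        have := Subalgebra.algebraMap_mem (Algebra.adjoin L {(1 : L) ⊗ₜ[R] t}) (algebraMap R L r)
        rwa [← IsScalarTower.algebraMap_apply, Algebra.TensorProduct.algebraMap_apply'] at this
      | add x y _ _ hx hy => rw [TensorProduct.tmul_add]; exact add_mem hx hy
      | mul x y _ _ hx hy =>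
        have := mul_mem hx hy
        rwa [Algebra.TensorProduct.tmul_mul_tmul, mul_one] at this
    have := Subalgebra.smul_mem _ h a
    rwa [TensorProduct.smul_tmul', smul_eq_mul, mul_one] at this

variable {L : Type*} [Field L] [Algebra R L] [Module.Finite R B]

/-- Translation by x is an automorphism, so it sends t to a generator with the same minimal
polynomial, whose value at the origin is `x t`. -/
theorem rootMultiplicity_minpoly_eq_finrank_localization [Coalgebra.IsCocomm R B] {t : B}
    (ht : Algebra.adjoin R {t} = ⊤) (x : B →ₐ[R] L) :
    rootMultiplicity (x t) (minpoly L ((1 : L) ⊗ₜ[R] t)) =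
      Module.finrank L (Localization.AtPrime (augIdeal L (L ⊗[R] B))) := by
  let T := AlgEquiv.ofBijective _ (translation_bijective (toConv x))
  have h1 := adjoin_one_tmul_eq_top L ht
  have h2 : Algebra.adjoin L {T (1 ⊗ₜ t)} = ⊤ := by
    have := AlgHom.map_adjoin (T : L ⊗[R] B →ₐ[L] L ⊗[R] B) {1 ⊗ₜ t}
    rw [h1, Set.image_singleton, Algebra.map_top] at this
    exact this.symm.trans ((AlgHom.range_eq_top _).mpr T.surjective)
  have h3 := finrank_localization_ker_eq_rootMultiplicity h2 (Bialgebra.counitAlgHom L (L ⊗[R] B))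
  rw [h3, minpoly.algEquiv_eq T]
  congr 1
  exact (counit_translation (toConv x) t).symm

omit [Module.Finite R B] in
theorem algHom_ext_of_adjoin_eq_top {S : Type*} [CommRing S] [Algebra R S] {t : B}
    (ht : Algebra.adjoin R {t} = ⊤) {x y : B →ₐ[R] S} (h : x t = y t) : x = y :=
  AlgHom.ext_of_adjoin_eq_top ht (by rintro _ rfl; exact h)

omit [Module.Finite R B] in
theorem aeval_minpoly_one_tmul {S : Type*} [CommRing S] [Algebra R S] [Algebra L S]
    [IsScalarTower R L S] (t : B) (x : B →ₐ[R] S) :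
    aeval (x t) (minpoly L ((1 : L) ⊗ₜ[R] t)) = 0 := by
  have h : extendScalarsHom (L := L) x (1 ⊗ₜ t) = x t := by simp
  rw [← h, aeval_algHom_apply, minpoly.aeval, map_zero]

omit [Module.Finite R B] in
theorem exists_algHom_of_isRoot {t : B} (ht : Algebra.adjoin R {t} = ⊤) {r : L}
    (hr : (minpoly L ((1 : L) ⊗ₜ[R] t)).IsRoot r) : ∃ x : B →ₐ[R] L, x t = r := by
  have h1 := adjoin_one_tmul_eq_top L ht
  have hs : Function.Surjective (aeval ((1 : L) ⊗ₜ[R] t) : L[X] →ₐ[L] L ⊗[R] B) := by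
    rw [← AlgHom.range_eq_top, ← Algebra.adjoin_singleton_eq_range_aeval, h1]
  have hk : ∀ q ∈ RingHom.ker (aeval ((1 : L) ⊗ₜ[R] t) : L[X] →ₐ[L] L ⊗[R] B),
      (aeval r : L[X] →ₐ[L] L) q = 0 := by
    intro q hq
    obtain ⟨q', rfl⟩ := minpoly.dvd L _ (RingHom.mem_ker.mp hq)
    rw [map_mul, coe_aeval_eq_eval, show eval r _ = 0 from hr, zero_mul]
  let g : L ⊗[R] B →ₐ[L] L := (Ideal.Quotient.liftₐ _ (aeval r : L[X] →ₐ[L] L) hk).comp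
    (Ideal.quotientKerAlgEquivOfSurjective hs).symm.toAlgHom
  have hg : g (1 ⊗ₜ t) = r := by
    have : (Ideal.quotientKerAlgEquivOfSurjective hs).symm (1 ⊗ₜ t) = Ideal.Quotient.mk _ X := by
      rw [AlgEquiv.symm_apply_eq]
      exact (aeval_X _).symm
    change Ideal.Quotient.liftₐ _ (aeval r : L[X] →ₐ[L] L) hk
      ((Ideal.quotientKerAlgEquivOfSurjective hs).symm (1 ⊗ₜ t)) = r
    rw [this]
    exact aeval_X r
  exact ⟨(g.restrictScalars R).comp Algebra.TensorProduct.includeRight, hg⟩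

open scoped Classical in
/-- The values of the points of `Spec B` at a generator `t` of the coordinate ring. -/
theorem range_eval_generator {t : B} (ht : Algebra.adjoin R {t} = ⊤) :
    Set.range (fun x : B →ₐ[R] L => x t) =
      ((minpoly L ((1 : L) ⊗ₜ[R] t)).roots.toFinset : Set L) := by
  have h0 : minpoly L ((1 : L) ⊗ₜ[R] t) ≠ 0 := minpoly.ne_zero (Algebra.IsIntegral.isIntegral _)
  ext r
  rw [Finset.mem_coe, Multiset.mem_toFinset, mem_roots h0]
  refine ⟨?_, fun h => exists_algHom_of_isRoot ht h⟩
  rintro ⟨x, rfl⟩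
  have := aeval_minpoly_one_tmul (L := L) t x
  rwa [coe_aeval_eq_eval] at this

theorem finite_algHom_of_adjoin_eq_top {t : B} (ht : Algebra.adjoin R {t} = ⊤) :
    Finite (B →ₐ[R] L) := by
  classical
  have h : (Set.range fun x : B →ₐ[R] L => x t).Finite := by
    rw [range_eval_generator ht]
    exact Finset.finite_toSet _
  have : Finite (Set.range fun x : B →ₐ[R] L => x t) := h
  exact Finite.of_injective (Set.rangeFactorization fun x : B →ₐ[R] L => x t) fun x y hxy =>
    algHom_ext_of_adjoin_eq_top ht (congrArg Subtype.val hxy)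

theorem card_algHom_mul_finrank_localization [Coalgebra.IsCocomm R B] [IsDomain R]
    [Module.Free R B] [IsAlgClosed L] {t : B}
    (ht : Algebra.adjoin R {t} = ⊤) :
    Nat.card (B →ₐ[R] L) * Module.finrank L (Localization.AtPrime (augIdeal L (L ⊗[R] B))) =
      Module.finrank R B := by
  classical
  set F := minpoly L ((1 : L) ⊗ₜ[R] t)
  have hd : F.natDegree = Module.finrank R B := by
    rw [natDegree_minpoly_eq_finrank_of_adjoin_eq_top (adjoin_one_tmul_eq_top L ht),
      Module.finrank_baseChange]
  have hcard : Nat.card (B →ₐ[R] L) = F.roots.toFinset.card := by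
    rw [← Set.ncard_coe_finset, ← range_eval_generator ht, ← Set.image_univ,
      Set.ncard_image_of_injective Set.univ fun (x y : B →ₐ[R] L) (h : x t = y t) =>
        algHom_ext_of_adjoin_eq_top ht h, Set.ncard_univ]
  rw [← hd, (IsAlgClosed.splits F).natDegree_eq_card_roots, ← Multiset.toFinset_sum_count_eq, hcard,
    ← smul_eq_mul]
  symm
  refine Finset.sum_eq_card_nsmul fun r hr => ?_
  rw [count_roots]
  have : r ∈ (F.roots.toFinset : Set L) := hr
  rw [← range_eval_generator ht] at this
  obtain ⟨x, rfl⟩ := this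
  exact rootMultiplicity_minpoly_eq_finrank_localization ht x

/-- Both polynomials are monic of degree the rank of B, and one divides the other. -/
theorem map_minpoly_one_tmul [IsDomain R] [Module.Free R B] (L : Type*) [Field L] [Algebra R L]
    (L' : Type*) [Field L'] [Algebra R L'] [Algebra L L'] [IsScalarTower R L L'] {t : B}
    (ht : Algebra.adjoin R {t} = ⊤) :
    (minpoly L ((1 : L) ⊗ₜ[R] t)).map (algebraMap L L') = minpoly L' ((1 : L') ⊗ₜ[R] t) := by
  have hm : (minpoly L ((1 : L) ⊗ₜ[R] t)).Monic := minpoly.monic (Algebra.IsIntegral.isIntegral _)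
  have hm' : (minpoly L' ((1 : L') ⊗ₜ[R] t)).Monic :=
    minpoly.monic (Algebra.IsIntegral.isIntegral _)
  refine eq_of_monic_of_dvd_of_natDegree_le hm' (hm.map _)
    (minpoly.dvd _ _ ?_) ?_
  · rw [aeval_map_algebraMap]
    exact aeval_minpoly_one_tmul (L := L) t
      (Algebra.TensorProduct.includeRight : B →ₐ[R] L' ⊗[R] B)
  · rw [natDegree_map, natDegree_minpoly_eq_finrank_of_adjoin_eq_top (adjoin_one_tmul_eq_top L ht),
      natDegree_minpoly_eq_finrank_of_adjoin_eq_top (adjoin_one_tmul_eq_top L' ht),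
      Module.finrank_baseChange, Module.finrank_baseChange]

theorem finrank_localization_augIdeal_eq [Coalgebra.IsCocomm R B] [IsDomain R] [Module.Free R B]
    (L : Type*) [Field L] [Algebra R L] (L' : Type*) [Field L'] [Algebra R L'] [Algebra L L']
    [IsScalarTower R L L'] {t : B} (ht : Algebra.adjoin R {t} = ⊤) :
    Module.finrank L' (Localization.AtPrime (augIdeal L' (L' ⊗[R] B))) =
      Module.finrank L (Localization.AtPrime (augIdeal L (L ⊗[R] B))) := by
  rw [← rootMultiplicity_minpoly_eq_finrank_localization ht
      (1 : WithConv (B →ₐ[R] L')).ofConv, ← rootMultiplicity_minpoly_eq_finrank_localization ht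
      (1 : WithConv (B →ₐ[R] L)).ofConv, ← map_minpoly_one_tmul L L' ht]
  have : (1 : WithConv (B →ₐ[R] L')).ofConv t =
      algebraMap L L' ((1 : WithConv (B →ₐ[R] L)).ofConv t) :=
    IsScalarTower.algebraMap_apply R L L' _
  rw [this]
  exact (eq_rootMultiplicity_map (algebraMap L L').injective _).symm

/-- On the closed fibre t is nilpotent, so its minimal polynomial is a power of X and the origin
carries the whole rank. -/
theorem finrank_localization_augIdeal_residueField [Coalgebra.IsCocomm R B] [IsDomain R]
    [IsLocalRing R] [Module.Free R B] [IsLocalRing B] {t : B} (ht : augIdeal R B = Ideal.span {t}) :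
    Module.finrank (IsLocalRing.ResidueField R)
      (Localization.AtPrime (augIdeal (IsLocalRing.ResidueField R)
        (IsLocalRing.ResidueField R ⊗[R] B))) = Module.finrank R B := by
  set k := IsLocalRing.ResidueField R
  have hgen := adjoin_generator_eq_top ht
  obtain ⟨j, hj⟩ := exists_pow_mem_map_maximalIdeal (R := R) (generator_mem_maximalIdeal ht)
  have h0 : ((1 : k) ⊗ₜ[R] t) ^ j = 0 := by
    have hle : (IsLocalRing.maximalIdeal R).map (algebraMap R B) ≤
        RingHom.ker (Algebra.TensorProduct.includeRight : B →ₐ[R] k ⊗[R] B) := by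
      rw [Ideal.map_le_iff_le_comap]
      intro r hr
      rw [Ideal.mem_comap, RingHom.mem_ker, AlgHom.commutes,
        IsScalarTower.algebraMap_apply R k (k ⊗[R] B)]
      rw [show algebraMap R k r = 0 from (IsLocalRing.residue_eq_zero_iff r).mpr hr, map_zero]
    have := hle hj
    rwa [RingHom.mem_ker, map_pow] at this
  have hdvd : minpoly k ((1 : k) ⊗ₜ[R] t) ∣ X ^ j := minpoly.dvd _ _ (by simpa using h0)
  obtain ⟨i, -, hi⟩ := (dvd_prime_pow (prime_X (R := k)) j).mp hdvd
  have hmin : minpoly k ((1 : k) ⊗ₜ[R] t) = X ^ i :=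
    eq_of_monic_of_associated (minpoly.monic (Algebra.IsIntegral.isIntegral _)) (monic_X_pow i) hi
  have hd := natDegree_minpoly_eq_finrank_of_adjoin_eq_top (adjoin_one_tmul_eq_top k hgen)
  rw [Module.finrank_baseChange, hmin, natDegree_X_pow] at hd
  rw [← rootMultiplicity_minpoly_eq_finrank_localization hgen
      (1 : WithConv (B →ₐ[R] k)).ofConv, hmin, ← hd]
  have : (1 : WithConv (B →ₐ[R] k)).ofConv t = 0 := by
    change algebraMap R k (Coalgebra.counit t) = 0
    rw [counit_eq_zero_of_generator ht, map_zero]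
  rw [this]
  simpa using rootMultiplicity_X_sub_C_pow (0 : k) i

end RootMultiplicity

end

/-! ### Inclusions between the levels, and torsion points. -/

noncomputable section

namespace PDivisibleGroup

variable {p : ℕ} {R : Type u} [CommRing R] (G : PDivisibleGroup.{u, v} p R)

/-- The comorphism of the inclusion `G_n → G_m` for `n ≤ m`. -/
def resLE {n m : ℕ} (h : n ≤ m) : G.B m →ₐc[R] G.B n :=
  Nat.leRec (motive := fun m _ => G.B m →ₐc[R] G.B n) (BialgHom.id R (G.B n))
    (fun m _ f => f.comp (G.res m)) h

theorem resLE_self (n : ℕ) : G.resLE (le_refl n) = BialgHom.id R (G.B n) :=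
  Nat.leRec_self _ _

theorem resLE_succ {n m : ℕ} (h : n ≤ m) :
    G.resLE (h.trans m.le_succ) = (G.resLE h).comp (G.res m) :=
  Nat.leRec_succ _ _ _

theorem resLE_surjective {n m : ℕ} (h : n ≤ m) : Function.Surjective (G.resLE h) := by
  induction m, h using Nat.le_induction with
  | base => rw [resLE_self]; exact Function.surjective_id
  | succ m h ih =>
    rw [G.resLE_succ h]
    exact ih.comp (G.res_surjective m)

theorem resLE_trans {n m l : ℕ} (h : n ≤ m) (h' : m ≤ l) :
    G.resLE (h.trans h') = (G.resLE h).comp (G.resLE h') := by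
  induction l, h' using Nat.le_induction with
  | base => rw [resLE_self]; rfl
  | succ l h' ih =>
    rw [G.resLE_succ h', G.resLE_succ (h.trans h'), ih]
    rfl

variable {G} {n m : ℕ} {S : Type*} [CommRing S] [Algebra R S]

namespace Points

theorem hom_zero (b : G.B n) :
    (0 : G.Points n S).hom b = algebraMap R S (Coalgebra.counit (R := R) b) := rfl

theorem hom_comap (f : G.B m →ₐc[R] G.B n) (x : G.Points n S) (b : G.B m) :
    (comap f x).hom b = x.hom (f b) := rfl

theorem eq_zero_of_forall {x : G.Points n S} (h : ∀ b ∈ augIdeal R (G.B n), x.hom b = 0) :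
    x = 0 := by
  refine Points.ext (AlgHom.ext fun b => ?_)
  have := h _ (sub_algebraMap_counit_mem_augIdeal b)
  rw [map_sub, AlgHom.commutes, sub_eq_zero] at this
  rw [this, hom_zero]

theorem hom_eq_zero_of_mem_augIdeal {b : G.B n} (hb : b ∈ augIdeal R (G.B n)) :
    (0 : G.Points n S).hom b = 0 := by
  rw [hom_zero, mem_augIdeal.mp hb, map_zero]

theorem hom_nsmul (k : ℕ) (x : G.Points n S) :
    (k • x).hom = x.hom.comp (mulByComorphism R (G.B n) k) := by
  induction k with
  | zero =>
    rw [zero_smul]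
    refine AlgHom.ext fun b => ?_
    rw [hom_zero]
    exact (x.hom.commutes _).symm
  | succ k ih =>
    rw [succ_nsmul]
    have h1 : (k • x + x).hom = (WithConv.toConv (k • x).hom * WithConv.toConv x.hom).ofConv := rfl
    rw [h1, ih, mulByComorphism, mulByComorphism, pow_succ, AlgHom.comp_convMul_distrib]
    rfl

theorem comap_injective {f : G.B m →ₐc[R] G.B n} (hf : Function.Surjective f) :
    Function.Injective (comap f : G.Points n S →+ G.Points m S) := by
  intro x y h
  refine Points.ext (AlgHom.ext fun b => ?_)
  obtain ⟨c, rfl⟩ := hf b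
  rw [← hom_comap, ← hom_comap, h]

theorem pow_smul_eq_zero (x : G.Points n S) : p ^ n • x = 0 := by
  refine comap_injective (G.res_surjective n) ?_
  rw [map_nsmul, map_zero]
  refine eq_zero_of_forall fun b hb => ?_
  rw [hom_nsmul, AlgHom.comp_apply, hom_comap]
  have : mulByComorphism R (G.B (n + 1)) (p ^ n) b ∈ RingHom.ker (G.res n) := by
    rw [G.ker_res]
    exact Ideal.mem_map_of_mem _ hb
  rw [RingHom.mem_ker.mp this, map_zero]

/-- A point killed by p^n vanishes on the ideal in `ker_res`, hence factors through the closed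
immersion i_n. -/
theorem exists_comap_res_eq {x : G.Points (n + 1) S} (hx : p ^ n • x = 0) :
    ∃ w : G.Points n S, comap (G.res n) w = x := by
  have hk : ∀ b ∈ RingHom.ker (G.res n : G.B (n + 1) →ₐ[R] G.B n), x.hom b = 0 := by
    intro b hb
    have hle : RingHom.ker (G.res n) ≤ RingHom.ker x.hom := by
      rw [G.ker_res, Ideal.map_le_iff_le_comap]
      intro c hc
      rw [Ideal.mem_comap, RingHom.mem_ker]
      have h1 : (p ^ n • x).hom c = x.hom (mulByComorphism R (G.B (n + 1)) (p ^ n) c) := by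
        rw [hom_nsmul, AlgHom.comp_apply]
      rw [← h1, hx, hom_eq_zero_of_mem_augIdeal hc]
    exact hle hb
  have hs : Function.Surjective (G.res n : G.B (n + 1) →ₐ[R] G.B n) := G.res_surjective n
  refine ⟨mk ((Ideal.Quotient.liftₐ _ x.hom hk).comp
    (Ideal.quotientKerAlgEquivOfSurjective hs).symm.toAlgHom), ?_⟩
  refine Points.ext (AlgHom.ext fun b => ?_)
  change Ideal.Quotient.liftₐ _ x.hom hk ((Ideal.quotientKerAlgEquivOfSurjective hs).symm _) = _
  have : (Ideal.quotientKerAlgEquivOfSurjective hs).symm (G.res n b) = Ideal.Quotient.mk _ b := by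
    rw [AlgEquiv.symm_apply_eq]
    rfl
  exact congrArg (Ideal.Quotient.liftₐ _ x.hom hk) this

theorem exists_comap_resLE_eq (h : n ≤ m) {x : G.Points m S} (hx : p ^ n • x = 0) :
    ∃ w : G.Points n S, comap (G.resLE h) w = x := by
  induction m, h using Nat.le_induction with
  | base => exact ⟨x, by rw [resLE_self]; rfl⟩
  | succ m h ih =>
    obtain ⟨w, rfl⟩ := exists_comap_res_eq (x := x) (by
      obtain ⟨k, rfl⟩ := Nat.exists_eq_add_of_le' h
      rw [pow_add, mul_smul, hx, smul_zero])
    rw [← map_nsmul, map_eq_zero_iff _ (comap_injective (G.res_surjective m))] at hx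
    obtain ⟨w', rfl⟩ := ih hx
    exact ⟨w', by rw [G.resLE_succ h]; rfl⟩

section Action

variable {A : Type w} [CommRing A] [G.RingAction A]

theorem comap_resLE_smul (h : n ≤ m) (a : A) (x : G.Points n S) :
    comap (G.resLE h) (a • x) = a • comap (G.resLE h) x := by
  induction m, h using Nat.le_induction with
  | base => rw [resLE_self]; rfl
  | succ m h ih =>
    rw [G.resLE_succ h]
    change comap (G.res m) (comap (G.resLE h) (a • x)) = a • comap (G.res m) (comap (G.resLE h) x)
    rw [ih, comap_res_smul]

theorem act_mem_augIdeal (a : A) {b : G.B n} (hb : b ∈ augIdeal R (G.B n)) :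
    RingAction.act n a b ∈ augIdeal R (G.B n) := by
  rw [mem_augIdeal, CoalgHomClass.counit_comp_apply]
  exact hb

end Action

end Points

theorem TateModule.comap_resLE {A : Type w} [CommRing A] [G.RingAction A] {ϖ : A}
    (y : G.TateModule A ϖ S) (n k : ℕ) :
    Points.comap (G.resLE (Nat.le_add_right n k)) (y.1 n) = ϖ ^ k • y.1 (n + k) := by
  induction k with
  | zero =>
    rw [pow_zero, one_smul]
    exact congrArg (fun f => Points.comap f (y.1 n)) (G.resLE_self n)
  | succ k ih =>
    have h1 : G.resLE (Nat.le_add_right n (k + 1)) =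
      (G.resLE (Nat.le_add_right n k)).comp (G.res (n + k)) := G.resLE_succ _
    rw [h1]
    change Points.comap (G.res (n + k)) (Points.comap (G.resLE _) (y.1 n)) = _
    rw [ih, G.comap_res_smul, (y.2 (n + k)).2, smul_smul, pow_succ]
    rfl

section Galois

variable {K L : Type*} [Field K] [Field L] [Algebra R K] [Algebra K L] [Algebra R L]
  [IsScalarTower R K L]

instance : DistribMulAction (L ≃ₐ[K] L) (G.Points n L) where
  smul σ x := Points.push ((σ : L →ₐ[K] L).restrictScalars R) x
  one_smul _ := rfl
  mul_smul _ _ _ := rfl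
  smul_zero σ := map_zero (Points.push ((σ : L →ₐ[K] L).restrictScalars R))
  smul_add σ := map_add (Points.push ((σ : L →ₐ[K] L).restrictScalars R))

theorem Points.comap_galois_smul (f : G.B m →ₐc[R] G.B n) (σ : L ≃ₐ[K] L) (x : G.Points n L) :
    comap f (σ • x) = σ • comap f x := rfl

theorem Points.galois_smul_smul {A : Type w} [CommRing A] [G.RingAction A] (σ : L ≃ₐ[K] L) (a : A)
    (x : G.Points n L) : σ • a • x = a • σ • x := rfl

end Galois

end PDivisibleGroup

end

noncomputable section

open Polynomial IsLocalRing

theorem augIdeal_eq_span_map {R B B' : Type*} [CommRing R] [CommRing B] [HopfAlgebra R B]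
    [CommRing B'] [HopfAlgebra R B'] {t : B} (ht : augIdeal R B = Ideal.span {t})
    {f : B →ₐc[R] B'} (hf : Function.Surjective f) : augIdeal R B' = Ideal.span {f t} := by
  refine le_antisymm ?_ ?_
  · intro b hb
    obtain ⟨c, rfl⟩ := hf b
    have hc : c ∈ augIdeal R B := by
      rwa [mem_augIdeal, CoalgHomClass.counit_comp_apply] at hb
    rw [ht, Ideal.mem_span_singleton] at hc
    rw [Ideal.mem_span_singleton]
    exact map_dvd f hc
  · rw [Ideal.span_singleton_le_iff_mem, mem_augIdeal, CoalgHomClass.counit_comp_apply,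
      counit_eq_zero_of_generator ht]

/-! ### Valuations of coordinates of points. -/

section Valuation

variable {R L Γ : Type*} [CommRing R] [Field L] [Algebra R L] [LinearOrderedCommGroupWithZero Γ]
  {V : Valuation L Γ}

theorem Valuation.map_algHom_le_one {B : Type*} [CommRing B] [Algebra R B] [Module.Finite R B]
    (hV : ∀ r : R, V (algebraMap R L r) ≤ 1) (x : B →ₐ[R] L) (b : B) : V (x b) ≤ 1 :=
  V.le_one_of_isIntegral hV ((Algebra.IsIntegral.isIntegral b).map x)

theorem Valuation.map_algHom_le_of_dvd {B : Type*} [CommRing B] [Algebra R B] [Module.Finite R B]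
    (hV : ∀ r : R, V (algebraMap R L r) ≤ 1) (x : B →ₐ[R] L) {b c : B} (h : b ∣ c) :
    V (x c) ≤ V (x b) := by
  obtain ⟨d, rfl⟩ := h
  rw [map_mul, map_mul]
  exact mul_le_of_le_one_right' (Valuation.map_algHom_le_one hV x d)

theorem Valuation.map_algHom_lt_one [IsLocalRing R] {B : Type*} [CommRing B] [HopfAlgebra R B]
    [Module.Finite R B] [IsLocalRing B] (hV : ∀ r : R, V (algebraMap R L r) ≤ 1) {π : R}
    (hm : maximalIdeal R = Ideal.span {π}) (hVπ : V (algebraMap R L π) < 1) (x : B →ₐ[R] L)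
    {b : B} (hb : b ∈ maximalIdeal B) : V (x b) < 1 := by
  obtain ⟨j, hj⟩ := exists_pow_mem_map_maximalIdeal (R := R) hb
  rw [hm, Ideal.map_span, Set.image_singleton, Ideal.mem_span_singleton] at hj
  have h := (Valuation.map_algHom_le_of_dvd hV x hj).trans_lt
    (by rw [AlgHom.commutes]; exact hVπ)
  by_contra! h1
  rw [map_pow, map_pow] at h
  exact h.not_ge (one_le_pow_of_one_le' h1 j)

/-- The constant term of the minimal polynomial over R is a non-zero multiple of z by an integral
element. -/
theorem Valuation.exists_pow_le_of_isIntegral [IsDomain R] [IsDiscreteValuationRing R]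
    [FaithfulSMul R L] (hV : ∀ r : R, V (algebraMap R L r) ≤ 1) {π : R} (hπ : Irreducible π) {z : L}
    (hz : IsIntegral R z) (h0 : z ≠ 0) : ∃ k : ℕ, V (algebraMap R L π) ^ k ≤ V z := by
  set c := (minpoly R z).coeff 0
  have hc : c ≠ 0 := by
    -- Otherwise a factor X could be divided off, against minimality.
    intro hc
    have h := divX_mul_X_add (minpoly R z)
    rw [show (minpoly R z).coeff 0 = 0 from hc, C_0, add_zero] at h
    have hm : (minpoly R z).divX.Monic := Monic.of_mul_monic_right monic_X (by
      rw [h]; exact minpoly.monic hz)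
    have h1 := congrArg (aeval z) h
    rw [map_mul, aeval_X, minpoly.aeval] at h1
    exact (minpoly.min R z hm ((mul_eq_zero.mp h1).resolve_right h0)).not_gt
      (degree_divX_lt (minpoly.ne_zero hz))
  have hle : V (algebraMap R L c) ≤ V z := by
    have h := congrArg (aeval z) (divX_mul_X_add (minpoly R z))
    rw [minpoly.aeval, map_add, map_mul, aeval_X, aeval_C, add_eq_zero_iff_neg_eq] at h
    rw [← h, Valuation.map_neg, map_mul]
    refine mul_le_of_le_one_left' (V.le_one_of_isIntegral hV ?_)
    exact Subalgebra.aeval_coe (integralClosure R L) ⟨z, hz⟩ _ ▸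
      (aeval (⟨z, hz⟩ : integralClosure R L) _).2
  obtain ⟨k, u, hu⟩ := IsDiscreteValuationRing.eq_unit_mul_pow_irreducible hc hπ
  refine ⟨k, ?_⟩
  rw [hu, map_mul, map_mul, V.algebraMap_eq_one_of_isUnit hV u.isUnit, one_mul, map_pow,
    map_pow] at hle
  exact hle

end Valuation

namespace PDivisibleGroup

variable {p : ℕ} {R : Type u} [CommRing R] {G : PDivisibleGroup.{u, v} p R}

theorem exists_coordinate [IsDomain R] [IsNoetherianRing R] [IsLocalRing R] (hconn : G.IsConnected)
    (hdim : G.HasDimension 1) (n : ℕ) : ∃ t, augIdeal R (G.B n) = Ideal.span {t} := by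
  have := hconn n
  rcases Nat.eq_zero_or_pos n with rfl | hn
  · exact ⟨0, exists_augIdeal_eq_span_of_finrank_eq_one (by rw [G.rank_eq, zero_mul, pow_zero])⟩
  · exact exists_augIdeal_eq_span_of_cotangent (hdim n hn)

/-! ### Multiplication by p in the coordinate. -/

section MulP

variable {m : ℕ} {t : G.B m} (ht : augIdeal R (G.B m) = Ideal.span {t})
include ht

theorem mulByComorphism_mem_augIdeal (k : ℕ) :
    mulByComorphism R (G.B m) k t ∈ augIdeal R (G.B m) := by
  have h : (k • (0 : G.Points m R)).hom t = 0 := by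
    rw [smul_zero, Points.hom_zero, counit_eq_zero_of_generator ht, map_zero]
  rwa [Points.hom_nsmul] at h

/-- Multiplication by p is zero on G_1, so the pull-back of t restricts to 0 there, and
`mem_sup_span_pow_finrank` applies. -/
theorem mulByComorphism_mem_sup [IsDomain R] [IsLocalRing R] (hconn : G.IsConnected) (hm : 1 ≤ m) :
    mulByComorphism R (G.B m) p t ∈ (maximalIdeal R).map (algebraMap R (G.B m)) ⊔
      Ideal.span {t ^ Module.finrank R (G.B 1)} := by
  have := hconn m
  have := hconn 1
  refine mem_sup_span_pow_finrank ht (G.resLE hm : G.B m →ₐ[R] G.B 1)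
    (augIdeal_eq_span_map ht (G.resLE_surjective hm)) ?_
  -- The universal point of G_1.
  let x : G.Points 1 (G.B 1) := Points.mk (AlgHom.id R _)
  have hx : p • Points.comap (G.resLE hm) x = 0 := by
    rw [← map_nsmul]
    have := Points.pow_smul_eq_zero x
    rw [pow_one] at this
    rw [this, map_zero]
  have h1 : (p • Points.comap (G.resLE hm) x).hom t = 0 := by
    rw [hx, Points.hom_zero, counit_eq_zero_of_generator ht, map_zero]
  rwa [Points.hom_nsmul] at h1

theorem exists_mulByComorphism_eq [IsDomain R] [IsLocalRing R] (hconn : G.IsConnected) (hm : 1 ≤ m)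
    {π : R} (hπ : π ≠ 0) (hmax : maximalIdeal R = Ideal.span {π}) :
    ∃ b₁ b₂, mulByComorphism R (G.B m) p t = algebraMap R (G.B m) π * (t * b₁) +
      t ^ Module.finrank R (G.B 1) * b₂ := by
  have := hconn 1
  refine exists_eq_of_mem_augIdeal ht hπ hmax (mulByComorphism_mem_augIdeal ht p) ?_
    (mulByComorphism_mem_sup ht hconn hm)
  exact (Module.finrank_pos).ne'

variable {L Γ : Type*} [Field L] [Algebra R L] [LinearOrderedCommGroupWithZero Γ]
  {V : Valuation L Γ} (hV : ∀ r : R, V (algebraMap R L r) ≤ 1)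
include hV

theorem Points.valuation_nsmul_le [IsDomain R] [IsLocalRing R] (hconn : G.IsConnected) (hm : 1 ≤ m)
    {π : R} (hπ : π ≠ 0) (hmax : maximalIdeal R = Ideal.span {π}) (x : G.Points m L) :
    V ((p • x).hom t) ≤ max (V (algebraMap R L π) * V (x.hom t))
      (V (x.hom t) ^ Module.finrank R (G.B 1)) := by
  obtain ⟨b₁, b₂, h⟩ := exists_mulByComorphism_eq ht hconn hm hπ hmax
  rw [hom_nsmul, AlgHom.comp_apply, h, map_add, map_mul, AlgHom.commutes]
  refine (V.map_add _ _).trans (max_le_max ?_ ?_)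
  · rw [map_mul]
    exact mul_le_mul_right (Valuation.map_algHom_le_of_dvd hV x.hom (Dvd.intro _ rfl)) _
  · rw [← map_pow, ← map_pow]
    exact Valuation.map_algHom_le_of_dvd hV x.hom (Dvd.intro _ rfl)

theorem Points.valuation_smul_le {A : Type w} [CommRing A] [G.RingAction A] (a : A)
    (x : G.Points m L) : V ((a • x).hom t) ≤ V (x.hom t) := by
  refine Valuation.map_algHom_le_of_dvd hV x.hom ?_
  rw [← Ideal.mem_span_singleton, ← ht]
  exact act_mem_augIdeal a (ht ▸ Ideal.mem_span_singleton_self t)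

/-- Restricting t gives another generator of the augmentation ideal, so the size of a point does not
depend on the level at which it is seen. -/
theorem Points.valuation_comap {n : ℕ} {t' : G.B n} (ht' : augIdeal R (G.B n) = Ideal.span {t'})
    {f : G.B m →ₐc[R] G.B n} (hf : Function.Surjective f) (x : G.Points n L) :
    V ((comap f x).hom t) = V (x.hom t') := by
  have h := augIdeal_eq_span_map ht hf
  rw [hom_comap]
  refine le_antisymm (Valuation.map_algHom_le_of_dvd hV x.hom ?_)
    (Valuation.map_algHom_le_of_dvd hV x.hom ?_)
  · rw [← Ideal.mem_span_singleton, ← ht', h]; exact Ideal.mem_span_singleton_self _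
  · rw [← Ideal.mem_span_singleton, ← h, ht']; exact Ideal.mem_span_singleton_self _

omit hV in
theorem Points.hom_generator_ne_zero {x : G.Points m L} (hx : x ≠ 0) : x.hom t ≠ 0 := by
  intro h
  refine hx (eq_zero_of_forall fun b hb => ?_)
  rw [ht, Ideal.mem_span_singleton] at hb
  obtain ⟨c, rfl⟩ := hb
  rw [map_mul, h, zero_mul]

end MulP

theorem finite_points [IsLocalRing R] [IsDomain R] [IsNoetherianRing R] (hconn : G.IsConnected)
    (hdim : G.HasDimension 1) (L : Type*) [Field L] [Algebra R L] (n : ℕ) :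
    Finite (G.Points n L) := by
  have := hconn n
  obtain ⟨t, ht⟩ := exists_coordinate hconn hdim n
  have : Finite (G.B n →ₐ[R] L) := finite_algHom_of_adjoin_eq_top (adjoin_generator_eq_top ht)
  exact Finite.of_injective (fun x : G.Points n L => x.hom) fun _ _ h => Points.ext h

theorem card_points_mul_finrank [IsLocalRing R] [IsDomain R] [IsNoetherianRing R]
    (hconn : G.IsConnected) (hdim : G.HasDimension 1) (K L : Type*) [Field K] [Algebra R K]
    [Field L] [Algebra R L] [Algebra K L] [IsScalarTower R K L] [IsAlgClosed L] (n : ℕ) :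
    Nat.card (G.Points n L) *
      Module.finrank K (Localization.AtPrime (augIdeal K (K ⊗[R] G.B n))) =
      Module.finrank R (G.B n) := by
  have := hconn n
  obtain ⟨t, ht⟩ := exists_coordinate hconn hdim n
  have h := adjoin_generator_eq_top ht
  have hcard : Nat.card (G.Points n L) = Nat.card (G.B n →ₐ[R] L) :=
    Nat.card_congr ⟨Points.hom, Points.mk, fun _ => rfl, fun _ => rfl⟩
  rw [← finrank_localization_augIdeal_eq K L h, hcard]
  exact card_algHom_mul_finrank_localization h

/-- The coordinate of x is a root of the polynomial defining G_n, all of whose roots have the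
multiplicity of the origin. -/
theorem natDegree_minpoly_hom_le [IsLocalRing R] [IsDomain R] [IsNoetherianRing R]
    (hconn : G.IsConnected) {K L : Type*} [Field K] [Algebra R K]
    [Field L] [Algebra R L] [Algebra K L] [IsScalarTower R K L] [IsAlgClosed L] [Normal K L] {n : ℕ}
    {t : G.B n} (ht : augIdeal R (G.B n) = Ideal.span {t}) (x : G.Points n L)
    (hfin : Finite (G.Points n L)) :
    (minpoly K (x.hom t)).natDegree ≤ Nat.card (MulAction.orbit (L ≃ₐ[K] L) x) *
      Module.finrank K (Localization.AtPrime (augIdeal K (K ⊗[R] G.B n))) := by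
  have := hconn n
  have h := adjoin_generator_eq_top ht
  have h0 : minpoly L ((1 : L) ⊗ₜ[R] t) ≠ 0 := minpoly.ne_zero (Algebra.IsIntegral.isIntegral _)
  have hle := natDegree_minpoly_le_mul_ncard_rootSet (K := K) (x.hom t) h0
    (M := Module.finrank K (Localization.AtPrime (augIdeal K (K ⊗[R] G.B n)))) ?_ ?_
  · refine hle.trans (Nat.mul_le_mul_right _ ?_)
    rw [Nat.card_coe_set_eq]
    have : Set.range (fun σ : L ≃ₐ[K] L => σ (x.hom t)) =
        (fun z : G.Points n L => z.hom t) '' MulAction.orbit (L ≃ₐ[K] L) x := by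
      rw [MulAction.orbit, ← Set.range_comp]
      rfl
    rw [this]
    exact Set.ncard_image_le (Set.toFinite _)
  · rw [← map_minpoly_one_tmul K L h]
    exact Polynomial.map_dvd _ (minpoly.dvd _ _ (aeval_minpoly_one_tmul t x.hom))
  · intro r
    by_cases hr : (minpoly L ((1 : L) ⊗ₜ[R] t)).IsRoot r
    · obtain ⟨z, rfl⟩ := exists_algHom_of_isRoot h hr
      rw [rootMultiplicity_minpoly_eq_finrank_localization h,
        finrank_localization_augIdeal_eq K L h]
    · rw [rootMultiplicity_eq_zero hr]
      exact Nat.zero_le _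

end PDivisibleGroup

end

noncomputable section

open Polynomial IsLocalRing

namespace PDivisibleGroup

variable {p : ℕ} {R : Type u} [CommRing R] {G : PDivisibleGroup.{u, v} p R}

/-! ### Orders of the fibres. -/

section Heights

variable [IsDomain R] [IsDiscreteValuationRing R] {A : Type w} [CommRing A] [Algebra A R]

/-- The closed fibre is connected, so #(A/p^n A)^s is the rank p^(nh). Extracting s-th roots gives
#(A/p^n A) = c^n with c = #(A/pA). -/
theorem exists_orders_eq_pow [Fact p.Prime] [CharP R p] (hconn : G.IsConnected)
    (hdim : G.HasDimension 1) {K : Type*} [Field K] [Algebra R K] {g s : ℕ}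
    (hs : G.HasFormalHeight A (ResidueField R) s) (hg : G.HasFormalHeight A K g) (hs0 : s ≠ 0) :
    ∃ c, 2 ≤ c ∧ (∀ n, Module.finrank R (G.B n) = c ^ (s * n)) ∧
      ∀ n, Module.finrank K (Localization.AtPrime (augIdeal K (K ⊗[R] G.B n))) = c ^ (g * n) := by
  set D : ℕ → ℕ := fun n => Nat.card (A ⧸ Ideal.span {(p : A) ^ n})
  have hN : ∀ n, Module.finrank R (G.B n) = D n ^ s := by
    intro n
    have := hconn n
    obtain ⟨t, ht⟩ := exists_coordinate hconn hdim n
    rw [← finrank_localization_augIdeal_residueField ht]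
    exact hs n
  have hD : ∀ n, D n = D 1 ^ n := by
    intro n
    refine Nat.pow_left_injective hs0 ?_
    change D n ^ s = (D 1 ^ n) ^ s
    rw [← hN, pow_right_comm, ← hN, G.rank_eq, G.rank_eq, one_mul, ← pow_mul, mul_comm]
  have hp : 0 < p := (Fact.out : p.Prime).pos
  have h0 : D 1 ≠ 0 := by
    intro h
    have := hN 1
    rw [G.rank_eq, h, zero_pow hs0] at this
    exact (pow_pos hp _).ne' this
  -- p vanishes in R, so it is not a unit of A.
  have h1 : D 1 ≠ 1 := by
    intro h
    have hsub : Subsingleton (A ⧸ Ideal.span {(p : A) ^ 1}) := (Nat.card_eq_one_iff_unique.mp h).1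
    rw [Ideal.Quotient.subsingleton_iff, pow_one, Ideal.span_singleton_eq_top] at hsub
    have := hsub.map (algebraMap A R)
    rw [map_natCast, CharP.cast_eq_zero] at this
    exact not_isUnit_zero this
  refine ⟨D 1, by omega, fun n => ?_, fun n => ?_⟩
  · rw [hN, hD, ← pow_mul, mul_comm]
  · rw [hg n]
    change D n ^ g = _
    rw [hD, ← pow_mul, mul_comm]

end Heights

/-! ### Lower bound for Galois orbits. -/

section Orbits

variable [IsDomain R] [IsDiscreteValuationRing R] {A : Type w} [CommRing A] [G.RingAction A]
  {K L : Type*} [Field K] [Algebra R K] [IsFractionRing R K]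
  [Field L] [Algebra R L] [Algebra K L] [IsScalarTower R K L] [IsAlgClosed L] [Normal K L]

theorem exists_pow_le_mul_card_orbit (hconn : G.IsConnected) (hdim : G.HasDimension 1)
    {a ε : A} (ha : a = ε * (p : A)) {w : ∀ n, G.Points n L}
    (hw : ∀ n, Points.comap (G.res n) (w n) = a • w (n + 1)) {n₁ : ℕ} (h₁ : 1 ≤ n₁)
    (hne : w n₁ ≠ 0) : ∃ D, ∀ j, Module.finrank R (G.B 1) ^ j ≤
      D * (Nat.card (MulAction.orbit (L ≃ₐ[K] L) (w (n₁ + j))) *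
        Module.finrank K (Localization.AtPrime (augIdeal K (K ⊗[R] G.B (n₁ + j))))) := by
  obtain ⟨π, hπ⟩ := IsDiscreteValuationRing.exists_irreducible R
  have hmax : maximalIdeal R = Ideal.span {π} := hπ.maximalIdeal_eq
  obtain ⟨𝒱, hV, hVm⟩ := exists_valuationSubring_of_isLocalRing R L
  set V := 𝒱.valuation
  have hVπ : V (algebraMap R L π) < 1 := hVm π (hmax ▸ Ideal.mem_span_singleton_self π)
  have hinj : Function.Injective (algebraMap R L) := by
    rw [IsScalarTower.algebraMap_eq R K L]
    exact (algebraMap K L).injective.comp (IsFractionRing.injective R K)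
  have : FaithfulSMul R L := (faithfulSMul_iff_algebraMap_injective R L).mpr hinj
  have hVπ0 : 0 < V (algebraMap R L π) := by
    rw [Valuation.pos_iff]
    exact (map_ne_zero_iff _ hinj).mpr hπ.ne_zero
  have hfin := fun n => finite_points hconn hdim L n
  choose t ht using exists_coordinate hconn hdim
  have hint (n : ℕ) (x : G.Points n L) : IsIntegral R (x.hom (t n)) :=
    (Algebra.IsIntegral.isIntegral (t n)).map x.hom
  -- G_{n₁} has finitely many points, so one exponent serves all conjugates of `w n₁`.
  obtain ⟨C, hC⟩ : ∃ C : ℕ, ∀ x : G.Points n₁ L, x ≠ 0 →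
      V (algebraMap R L π) ^ C ≤ V (x.hom (t n₁)) := by
    have h (x : G.Points n₁ L) : ∃ k : ℕ, x ≠ 0 →
        V (algebraMap R L π) ^ k ≤ V (x.hom (t n₁)) := by
      by_cases hx : x = 0
      · exact ⟨0, fun h => absurd hx h⟩
      · obtain ⟨k, hk⟩ := Valuation.exists_pow_le_of_isIntegral hV hπ (hint _ x)
          (Points.hom_generator_ne_zero (ht n₁) hx)
        exact ⟨k, fun _ => hk⟩
    choose k hk using h
    obtain ⟨C, hC⟩ := (Set.finite_range k).bddAbove
    exact ⟨C, fun x hx =>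
      (pow_le_pow_right_of_le_one' hVπ.le (hC (Set.mem_range_self x))).trans (hk x hx)⟩
  have hd : Module.finrank R (G.B 1) ≠ 0 := by
    have := hconn 1
    exact Module.finrank_pos.ne'
  have hlt (n : ℕ) (x : G.Points n L) : V (x.hom (t n)) < 1 := by
    have := hconn n
    exact Valuation.map_algHom_lt_one hV hmax hVπ x.hom (generator_mem_maximalIdeal (ht n))
  have hdyn (σ : L ≃ₐ[K] L) (j : ℕ) :
      V (algebraMap R L π) ^ (C * Module.finrank R (G.B 1) ^ C) ≤
        V ((σ • w (n₁ + j)).hom (t (n₁ + j))) ^ Module.finrank R (G.B 1) ^ j := by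
    refine pow_mul_pow_le_pow_of_le_max hVπ0 hVπ hd
      (x := fun j => V ((σ • w (n₁ + j)).hom (t (n₁ + j)))) (fun j => hlt _ _) (fun j => ?_)
      (hC _ ?_) j
    · change V ((σ • w (n₁ + j)).hom (t (n₁ + j))) ≤
        max (V (algebraMap R L π) * V ((σ • w (n₁ + j + 1)).hom (t (n₁ + j + 1)))) _
      -- Seen one level higher, the point is p times a conjugate of the next one, up to the action
      -- of ε, which does not increase values.
      rw [← Points.valuation_comap (ht (n₁ + j + 1)) hV (ht (n₁ + j)) (G.res_surjective (n₁ + j)),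
        Points.comap_galois_smul, hw, Points.galois_smul_smul, ha, mul_smul,
        Nat.cast_smul_eq_nsmul]
      refine (Points.valuation_smul_le (ht _) hV _ _).trans ?_
      exact Points.valuation_nsmul_le (ht _) hV hconn (by omega) hπ.ne_zero hmax _
    · exact (smul_ne_zero_iff_ne σ).mpr hne
  refine ⟨C * Module.finrank R (G.B 1) ^ C, fun j => ?_⟩
  refine le_trans ?_ (Nat.mul_le_mul_left _
    (natDegree_minpoly_hom_le (K := K) hconn (ht (n₁ + j)) (w (n₁ + j)) (hfin _)))
  have hroot (r : L) (hr : aeval r (minpoly K ((w (n₁ + j)).hom (t (n₁ + j)))) = 0) :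
      ∃ σ : L ≃ₐ[K] L, (σ • w (n₁ + j)).hom (t (n₁ + j)) = r :=
    minpoly.exists_algEquiv_of_root' (hint _ _).tower_top.isAlgebraic hr
  refine le_mul_natDegree_minpoly V hV hπ hVπ (hint _ _) (fun r hr => ?_) fun r hr => ?_
  · obtain ⟨σ, rfl⟩ := hroot r hr
    exact hlt _ _
  · obtain ⟨σ, rfl⟩ := hroot r hr
    exact hdyn σ j

end Orbits

/-! ### Stabilizers acting on the fibres of the tower. -/

section Fibres

variable {A : Type w} [CommRing A] [G.RingAction A]

/-- As a divides p, differences of points of the fibre are p-torsion, so they lie in G_1. -/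
theorem Points.ncard_smul_eq_le {L : Type*} [CommRing L] [Algebra R L]
    [∀ n, Finite (G.Points n L)] {a ε : A}
    (ha : (p : A) = ε * a) {n : ℕ} (w : G.Points n L) (z : G.Points (n + 1) L)
    (hz : comap (G.res n) w = a • z) :
    {x : G.Points (n + 1) L | a • x = comap (G.res n) w}.ncard ≤ Nat.card (G.Points 1 L) := by
  have h (x : {x : G.Points (n + 1) L | a • x = comap (G.res n) w}) :
      ∃ y : G.Points 1 L, comap (G.resLE (Nat.le_add_left 1 n)) y = x - z := by
    refine exists_comap_resLE_eq _ ?_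
    have hx : a • (x : G.Points (n + 1) L) = comap (G.res n) w := x.2
    rw [pow_one, ← Nat.cast_smul_eq_nsmul A, ha, mul_smul, smul_sub, hx, hz, sub_self, smul_zero]
  choose f hf using h
  rw [← Nat.card_coe_set_eq]
  refine Nat.card_le_card_of_injective f fun x y hxy => Subtype.ext ?_
  have := hf x
  rw [hxy, hf y] at this
  exact (sub_left_injective this).symm

/-- The stabilizers form a decreasing chain, so the orbit of w_{n+1} is larger than that of w_n by a
factor F_n, the size of the orbit of w_{n+1} under the stabilizer of w_n. This orbit lies in a fibre
of at most #G_1(L) points; `eventually_eq_of_pow_le_mul` makes it fill the fibre eventually. -/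
theorem exists_forall_mem_orbit_of_smul_eq {L Γ : Type*} [CommRing L] [Algebra R L] [Group Γ]
    [∀ n, MulAction Γ (G.Points n L)] [∀ n, Finite (G.Points n L)]
    (hcomap : ∀ (n : ℕ) (σ : Γ) (x : G.Points n L),
      Points.comap (G.res n) (σ • x) = σ • Points.comap (G.res n) x)
    (hsmul : ∀ (n : ℕ) (σ : Γ) (a : A) (x : G.Points n L), σ • a • x = a • σ • x)
    {a ε : A} (ha : (p : A) = ε * a) {w : ∀ n, G.Points n L}
    (hw : ∀ n, Points.comap (G.res n) (w n) = a • w (n + 1)) {n₁ D : ℕ}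
    (hD : ∀ n, n₁ ≤ n → Nat.card (G.Points 1 L) ^ n ≤ D * Nat.card (MulAction.orbit Γ (w n))) :
    ∃ N, ∀ n, N ≤ n → ∀ x : G.Points (n + 1) L, a • x = Points.comap (G.res n) (w n) →
      ∃ σ : Γ, σ • w n = w n ∧ σ • w (n + 1) = x := by
  have hle (n : ℕ) : MulAction.stabilizer Γ (w (n + 1)) ≤ MulAction.stabilizer Γ (w n) := by
    intro σ hσ
    rw [MulAction.mem_stabilizer_iff] at hσ ⊢
    refine Points.comap_injective (G.res_surjective n) ?_
    rw [hcomap, hw, hsmul, hσ]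
  set F : ℕ → ℕ := fun n =>
    (MulAction.orbit (MulAction.stabilizer Γ (w n)) (w (n + 1))).ncard with hF
  have hsub (n : ℕ) : MulAction.orbit (MulAction.stabilizer Γ (w n)) (w (n + 1)) ⊆
      {x : G.Points (n + 1) L | a • x = Points.comap (G.res n) (w n)} := by
    rintro _ ⟨⟨σ, hσ⟩, rfl⟩
    change a • σ • w (n + 1) = _
    rw [← hsmul, ← hw, ← hcomap, hσ]
  have hFle (n : ℕ) : F n ≤ Nat.card (G.Points 1 L) :=
    (Set.ncard_le_ncard (hsub n) (Set.toFinite _)).trans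
      (Points.ncard_smul_eq_le ha (w n) (w (n + 1)) (hw n))
  have hmul (n : ℕ) : Nat.card (MulAction.orbit Γ (w (n + 1))) =
      F n * Nat.card (MulAction.orbit Γ (w n)) := by
    rw [Nat.card_coe_set_eq, Nat.card_coe_set_eq, ← MulAction.index_stabilizer,
      ← MulAction.index_stabilizer, ← Subgroup.relIndex_mul_index (hle n), hF]
    simp only
    rw [← MulAction.index_stabilizer]
    rfl
  obtain ⟨N, hN⟩ := eventually_eq_of_pow_le_mul Nat.card_pos hmul hFle hD
  refine ⟨N, fun n hn x hx => ?_⟩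
  have hx' : x ∈ MulAction.orbit (MulAction.stabilizer Γ (w n)) (w (n + 1)) := by
    rw [Set.eq_of_subset_of_ncard_le (hsub n) ?_ (Set.toFinite _)]
    · exact hx
    · exact (Points.ncard_smul_eq_le ha (w n) (w (n + 1)) (hw n)).trans (hN n hn).ge
  obtain ⟨⟨σ, hσ⟩, h⟩ := hx'
  exact ⟨σ, hσ, h⟩

end Fibres

end PDivisibleGroup

end

noncomputable section

/-! ### A criterion for irreducibility. -/

section Irreducible

/-- The extension of scalars to `E` of a representation over `A`. -/
def Representation.extendScalars {A T Γ : Type*} [CommRing A] [AddCommGroup T] [Module A T]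
    [Group Γ] (ρ : Representation A Γ T) (E : Type*) [Field E] [Algebra A E] :
    Representation E Γ (E ⊗[A] T) :=
  (Module.End.baseChangeHom A E T : _ →* _).comp ρ

/-- If the translates `y + a T` of the lattice `T` are contained in the orbits of its nonzero
elements `y`, then the representation on `E ⊗ T` is irreducible. -/
theorem Representation.isIrreducible_extendScalars_of_forall_exists {A T Γ : Type*} [CommRing A]
    [IsDomain A] [AddCommGroup T] [Module A T] [Module.IsTorsionFree A T] [Nontrivial T] [Group Γ]
    (ρ : Representation A Γ T) (E : Type*) [Field E] [Algebra A E] [IsFractionRing A E]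
    (h : ∀ y : T, y ≠ 0 → ∃ a : A, a ≠ 0 ∧ ∀ z : T, ∃ σ, ρ σ y = y + a • z) :
    (ρ.extendScalars E).IsIrreducible := by
  have hloc : IsLocalizedModule (nonZeroDivisors A) (TensorProduct.mk A E T 1) := inferInstance
  have hinj (y : T) (hy : (1 : E) ⊗ₜ[A] y = 0) : y = 0 := by
    obtain ⟨s, hs⟩ := (IsLocalizedModule.eq_zero_iff (nonZeroDivisors A)
      (TensorProduct.mk A E T 1)).mp hy
    exact (smul_eq_zero.mp hs).resolve_left (nonZeroDivisors.coe_ne_zero s)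
  have hne : ∃ x : E ⊗[A] T, x ≠ 0 := by
    obtain ⟨y, hy⟩ := exists_ne (0 : T)
    exact ⟨1 ⊗ₜ y, fun h => hy (hinj y h)⟩
  refine { exists_pair_ne := ⟨⊥, ⊤, ?_⟩, eq_bot_or_eq_top := fun W => ?_ }
  · intro hbt
    obtain ⟨x, hx⟩ := hne
    have : x ∈ (⊥ : Subrepresentation (ρ.extendScalars E)) := by
      rw [hbt]
      exact Submodule.mem_top
    exact hx ((Submodule.mem_bot E).mp this)
  · rw [or_iff_not_imp_left]
    intro hW
    have hv : ∃ v ∈ W.toSubmodule, v ≠ 0 := by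
      refine Submodule.exists_mem_ne_zero_of_ne_bot fun h0 => hW ?_
      exact Subrepresentation.toSubmodule_injective h0
    obtain ⟨v, hvW, hv0⟩ := hv
    -- Clearing denominators puts a non-zero lattice vector y into W.
    obtain ⟨⟨y, s⟩, hs⟩ := IsLocalizedModule.surj (nonZeroDivisors A) (TensorProduct.mk A E T 1) v
    have hs0 : algebraMap A E s ≠ 0 := by
      rw [Ne, FaithfulSMul.algebraMap_eq_zero_iff]
      exact nonZeroDivisors.coe_ne_zero s
    replace hs : algebraMap A E s • v = 1 ⊗ₜ[A] y := by
      rw [algebraMap_smul]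
      exact hs
    have hyW : (1 : E) ⊗ₜ[A] y ∈ W.toSubmodule := hs ▸ W.toSubmodule.smul_mem _ hvW
    have hy0 : y ≠ 0 := by
      rintro rfl
      rw [TensorProduct.tmul_zero, smul_eq_zero] at hs
      exact hs.elim hs0 hv0
    obtain ⟨a, ha, hz⟩ := h y hy0
    -- W contains y and y + a z, and a is invertible in E.
    have hone (z : T) : (1 : E) ⊗ₜ[A] z ∈ W.toSubmodule := by
      obtain ⟨σ, hσ⟩ := hz z
      have h1 := W.apply_mem_toSubmodule σ hyW
      have h2 : ρ.extendScalars E σ ((1 : E) ⊗ₜ[A] y) = 1 ⊗ₜ[A] ρ σ y :=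
        LinearMap.baseChange_tmul _ _ _
      rw [h2, hσ, TensorProduct.tmul_add, Submodule.add_mem_iff_right _ hyW,
        TensorProduct.tmul_smul, ← algebraMap_smul E] at h1
      rwa [Submodule.smul_mem_iff] at h1
      rwa [Ne, FaithfulSMul.algebraMap_eq_zero_iff]
    refine Subrepresentation.toSubmodule_injective (eq_top_iff.mpr fun x _ => ?_)
    induction x with
    | zero => exact zero_mem _
    | add a b ha hb => exact add_mem (ha Submodule.mem_top) (hb Submodule.mem_top)
    | tmul e z =>
      have := W.toSubmodule.smul_mem e (hone z)
      rwa [TensorProduct.smul_tmul', smul_eq_mul, mul_one] at this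

end Irreducible

namespace PDivisibleGroup

variable {p : ℕ} {R : Type u} [CommRing R] {G : PDivisibleGroup.{u, v} p R}
variable {A : Type w} [CommRing A] [G.RingAction A] {ϖ : A}

/-! ### The Tate module and its levels. -/

section TateModule

variable {S : Type*} [CommRing S] [Algebra R S]

theorem TateModule.eq_of_apply_eq {y y' : G.TateModule A ϖ S} {m n : ℕ} (h : m ≤ n)
    (hn : y.1 n = y'.1 n) : y.1 m = y'.1 m := by
  obtain ⟨k, rfl⟩ := Nat.exists_eq_add_of_le h
  refine Points.comap_injective (G.resLE_surjective (Nat.le_add_right m k)) ?_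
  rw [comap_resLE, comap_resLE, hn]

theorem TateModule.smul_apply_zero (y : G.TateModule A ϖ S) (n : ℕ) :
    (ϖ ^ n • y).1 n = 0 := (y.2 n).1

theorem TateModule.isTorsionFree [IsDomain A] [IsDiscreteValuationRing A] (hϖ : Irreducible ϖ) :
    Module.IsTorsionFree A (G.TateModule A ϖ S) := by
  have h1 (y : G.TateModule A ϖ S) (h : ϖ • y = 0) : y = 0 := by
    refine Subtype.ext (funext fun n => ?_)
    refine Points.comap_injective (G.res_surjective n) ?_
    rw [(y.2 n).2]
    have : (ϖ • y).1 (n + 1) = 0 := by rw [h]; rfl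
    exact this.trans (map_zero _).symm
  rw [Module.isTorsionFree_iff_smul_eq_zero]
  intro a y h
  by_contra! hne
  obtain ⟨k, u, rfl⟩ := IsDiscreteValuationRing.eq_unit_mul_pow_irreducible hne.1 hϖ
  have h2 : ϖ ^ k • y = 0 := by
    rw [mul_smul] at h
    exact (smul_eq_zero_iff_eq u).mp h
  clear h
  induction k with
  | zero => exact hne.2 (by simpa using h2)
  | succ k ih =>
    rw [pow_succ', mul_smul] at h2
    exact ih (by simpa [hϖ.ne_zero] using hne) (h1 _ h2)

/-- Passing from steps of ϖ to steps of ϖ^e: `y (e * n)` is killed by ϖ^(en), hence by p^n, so it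
comes from G_n. -/
theorem TateModule.exists_sequence {e : ℕ} (he : 1 ≤ e) {u : A} (hp : (p : A) = u * ϖ ^ e)
    (y : G.TateModule A ϖ S) :
    ∃ w : ∀ n, G.Points n S,
      (∀ n, Points.comap (G.resLE (Nat.le_mul_of_pos_left n he)) (w n) = y.1 (e * n)) ∧
      ∀ n, Points.comap (G.res n) (w n) = ϖ ^ e • w (n + 1) := by
  have h (n : ℕ) : ∃ w : G.Points n S,
      Points.comap (G.resLE (Nat.le_mul_of_pos_left n he)) w = y.1 (e * n) := by
    refine Points.exists_comap_resLE_eq _ ?_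
    rw [← Nat.cast_smul_eq_nsmul A, Nat.cast_pow, hp, mul_pow, ← pow_mul, mul_smul,
      (y.2 (e * n)).1, smul_zero]
  choose w hw using h
  refine ⟨w, hw, fun n => ?_⟩
  refine Points.comap_injective (G.resLE_surjective (Nat.le_mul_of_pos_left (n + 1) he)) ?_
  rw [Points.comap_resLE_smul, hw (n + 1)]
  have h1 := TateModule.comap_resLE y (e * n) e
  rw [← hw n] at h1
  refine Eq.trans ?_ h1
  have h2 : (G.resLE n.le_succ).comp (G.resLE (Nat.le_mul_of_pos_left (n + 1) he)) =
      (G.resLE (Nat.le_mul_of_pos_left n he)).comp (G.resLE (Nat.le_add_right (e * n) e)) := by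
    rw [← G.resLE_trans]
    exact G.resLE_trans (Nat.le_mul_of_pos_left n he) (Nat.le_add_right (e * n) e)
  have h3 : G.resLE n.le_succ = G.res n := by
    rw [G.resLE_succ le_rfl, G.resLE_self]
    rfl
  rw [h3] at h2
  exact congrArg (fun f => Points.comap f (w n)) h2

theorem TateModule.isOpen_of_forall_exists {U : Set (G.TateModule A ϖ S)}
    (h : ∀ z ∈ U, ∃ M, ∀ z' : G.TateModule A ϖ S, z'.1 M = z.1 M → z' ∈ U) : IsOpen U := by
  let _ : ∀ n, TopologicalSpace (G.Points n S) := fun _ => ⊥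
  have (n : ℕ) : DiscreteTopology (G.Points n S) := ⟨rfl⟩
  rw [isOpen_iff_mem_nhds]
  intro z hz
  obtain ⟨M, hM⟩ := h z hz
  have hc : Continuous fun y : G.TateModule A ϖ S => y.1 M :=
    (continuous_apply M).comp continuous_induced_dom
  exact Filter.mem_of_superset ((isOpen_discrete {z.1 M}).preimage hc |>.mem_nhds rfl) hM

end TateModule

end PDivisibleGroup

end

noncomputable section

namespace PDivisibleGroup

variable {p : ℕ} {R : Type u} [CommRing R] {G : PDivisibleGroup.{u, v} p R}
variable {A : Type w} [CommRing A] [G.RingAction A] {ϖ : A}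

/-! ### Divisibility by p, and non-vanishing of the Tate module. -/

section Divisibility

variable {S : Type*} [CommRing S] [Algebra R S] [∀ n, Finite (G.Points n S)]

/-- The p-torsion has at most #G_1(S) elements, so p G_{n+1}(S) has at least #G_1(S)^n. It lies in
G_n(S), which has exactly that many. -/
theorem Points.exists_nsmul_eq_comap_res
    (hcard : ∀ n, Nat.card (G.Points n S) = Nat.card (G.Points 1 S) ^ n) {n : ℕ}
    (z : G.Points n S) : ∃ x : G.Points (n + 1) S, p • x = comap (G.res n) z := by
  let φ : G.Points (n + 1) S →+ G.Points (n + 1) S := nsmulAddMonoidHom p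
  let r : G.Points n S →+ G.Points (n + 1) S := comap (G.res n)
  have hle : φ.range ≤ r.range := by
    rintro _ ⟨x, rfl⟩
    refine exists_comap_res_eq ?_
    change p ^ n • p • x = 0
    rw [smul_smul, ← pow_succ, pow_smul_eq_zero]
  have hr : Nat.card r.range = Nat.card (G.Points 1 S) ^ n := by
    rw [← hcard n]
    exact (Nat.card_congr (AddMonoidHom.ofInjective
      (comap_injective (G.res_surjective n))).toEquiv).symm
  have hker : Nat.card φ.ker ≤ Nat.card (G.Points 1 S) := by
    have h (x : φ.ker) : ∃ y : G.Points 1 S, comap (G.resLE (Nat.le_add_left 1 n)) y = x := by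
      refine exists_comap_resLE_eq _ ?_
      rw [pow_one]
      exact x.2
    choose f hf using h
    refine Nat.card_le_card_of_injective f fun x y hxy => Subtype.ext ?_
    rw [← hf x, ← hf y, hxy]
  have hmul : Nat.card φ.ker * Nat.card φ.range = Nat.card (G.Points 1 S) ^ (n + 1) := by
    rw [← hcard (n + 1), ← AddSubgroup.index_ker, AddSubgroup.card_mul_index]
  have hge : Nat.card r.range ≤ Nat.card φ.range := by
    rw [hr]
    refine le_of_mul_le_mul_left ?_ (Nat.card_pos (α := G.Points 1 S))
    rw [← pow_succ', ← hmul]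
    exact Nat.mul_le_mul_right _ hker
  have heq := AddSubgroup.eq_of_le_of_card_ge hle hge
  have : r z ∈ φ.range := heq ▸ ⟨z, rfl⟩
  exact this

theorem TateModule.exists_ne_zero
    (hcard : ∀ n, Nat.card (G.Points n S) = Nat.card (G.Points 1 S) ^ n)
    (h1 : 1 < Nat.card (G.Points 1 S)) {e : ℕ} (he : 1 ≤ e) (u : Aˣ) (hp : (p : A) = u * ϖ ^ e) :
    ∃ y : G.TateModule A ϖ S, y ≠ 0 := by
  choose f hf using fun n => Points.exists_nsmul_eq_comap_res hcard (n := n)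
  have : Nontrivial (G.Points 1 S) := Finite.one_lt_card_iff_nontrivial.mp h1
  obtain ⟨x, hx⟩ := exists_ne (0 : G.Points 1 S)
  let w : ∀ n, G.Points (n + 1) S := fun n => Nat.rec x (fun n z => f (n + 1) z) n
  have hw (n : ℕ) : (p : A) • w (n + 1) = Points.comap (G.res (n + 1)) (w n) := by
    rw [Nat.cast_smul_eq_nsmul]
    exact hf (n + 1) (w n)
  have hw0 (n : ℕ) :
      (p : A) ^ n • w n = Points.comap (G.resLE (Nat.le_add_left 1 n)) x := by
    induction n with
    | zero =>
      rw [pow_zero, one_smul]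
      exact (congrArg (fun f => Points.comap f x) (G.resLE_self 1)).symm
    | succ n ih =>
      rw [pow_succ, mul_smul, hw, ← comap_res_smul, ih]
      exact (congrArg (fun f => Points.comap f x) (G.resLE_succ (Nat.le_add_left 1 n))).symm
  obtain ⟨e, rfl⟩ := Nat.exists_eq_add_of_le' he
  set c : A := u * ϖ ^ e
  have hc : (p : A) = ϖ * c := by rw [hp, pow_succ]; ring
  -- Since p = ϖ c, the points c^(n+1) w_n are killed by ϖ^(n+1) and compatible. As w_n lives at
  -- level n+1, the sequence starts with 0 at level 0.
  refine ⟨⟨fun n => Nat.casesOn n 0 fun n => c ^ (n + 1) • w n, fun n => ?_⟩, fun h => ?_⟩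
  · cases n with
    | zero =>
      refine ⟨smul_zero _, ?_⟩
      change Points.comap (G.res 0) 0 = ϖ • c ^ (0 + 1) • w 0
      have h0 : p • w 0 = 0 :=
        (congrArg (· • w 0) (pow_one p).symm).trans (Points.pow_smul_eq_zero (w 0))
      rw [map_zero, smul_smul, pow_succ, pow_zero, one_mul, ← hc, Nat.cast_smul_eq_nsmul, h0]
    | succ n =>
      refine ⟨?_, ?_⟩
      · change ϖ ^ (n + 1) • c ^ (n + 1) • w n = 0
        rw [smul_smul, ← mul_pow, ← hc, ← Nat.cast_pow, Nat.cast_smul_eq_nsmul,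
          Points.pow_smul_eq_zero]
      · change Points.comap (G.res (n + 1)) (c ^ (n + 1) • w n) = ϖ • c ^ (n + 1 + 1) • w (n + 1)
        rw [comap_res_smul, ← hw, smul_smul, smul_smul, hc]
        congr 1
        ring
  · have h2 : c ^ (e + 1) • w e = 0 := congrFun (congrArg Subtype.val h) (e + 1)
    have h3 : c ^ (e + 1) = u * (p : A) ^ e := by
      rw [hp]
      simp only [c]
      ring
    rw [h3, mul_smul, hw0] at h2
    have h4 := (smul_eq_zero_iff_eq u).mp h2
    rw [map_eq_zero_iff _ (Points.comap_injective (G.resLE_surjective _))] at h4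
    exact hx h4

end Divisibility

/-! ### From finite levels to the Galois group. -/

section Monodromy

variable [IsDomain R] [IsDiscreteValuationRing R]
  {K L : Type*} [Field K] [Algebra R K] [IsFractionRing R K]
  [Field L] [Algebra R L] [Algebra K L] [IsScalarTower R K L]

omit [IsDomain R] [IsDiscreteValuationRing R] [IsFractionRing R K] in
-- Compactness: finitely many coordinates are controlled by a single level, because each level
-- determines the lower ones.
theorem TateModule.exists_push_eq_of_forall [IsAlgClosed L] [Algebra.IsAlgebraic K L]
    {y y' : G.TateModule A ϖ L}
    (h : ∀ n, ∃ σ : L ≃ₐ[K] L, σ • y.1 n = y'.1 n) :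
    ∃ σ : L ≃ₐ[K] L, ∀ n, σ • y.1 n = y'.1 n := by
  obtain ⟨σ, hσ⟩ := exists_algEquiv_of_forall_finset (K := K)
    (fun i : Σ n, G.B n => (y.1 i.1).hom i.2) (fun i => (y'.1 i.1).hom i.2) (fun s => by
      obtain ⟨σ, hσ⟩ := h (s.sup Sigma.fst)
      refine ⟨σ, fun i hi => ?_⟩
      have hm : i.1 ≤ s.sup Sigma.fst := Finset.le_sup (f := Sigma.fst) hi
      have := TateModule.eq_of_apply_eq
        (y := TateModule.push G A ϖ ((σ : L →ₐ[K] L).restrictScalars R) y) (y' := y') hm hσ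
      exact DFunLike.congr_fun (congrArg Points.hom this) i.2)
  exact ⟨σ, fun n => Points.ext (AlgHom.ext fun b => hσ ⟨n, b⟩)⟩

/-- Once stabilizers are transitive on fibres, agreement at one level is carried upwards by
correcting the automorphism at each step. The level is e N because w_N is `y (e * N)`. -/
theorem TateModule.exists_push_eq_of_apply_eq [IsAlgClosed L] [Normal K L]
    (hconn : G.IsConnected) (hdim : G.HasDimension 1) {c g s : ℕ} (hc : 2 ≤ c) (hgs : g ≤ s)
    (hN : ∀ n, Module.finrank R (G.B n) = c ^ (s * n))
    (hM : ∀ n, Module.finrank K (Localization.AtPrime (augIdeal K (K ⊗[R] G.B n))) = c ^ (g * n))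
    (hcard : ∀ n, Nat.card (G.Points n L) = c ^ ((s - g) * n))
    {e : ℕ} (he : 1 ≤ e) (u : Aˣ) (hp : (p : A) = u * ϖ ^ e)
    {y : G.TateModule A ϖ L} (hy : y ≠ 0) :
    ∃ M, ∀ y' : G.TateModule A ϖ L, y'.1 M = y.1 M →
      ∃ σ : L ≃ₐ[K] L, ∀ n, σ • y.1 n = y'.1 n := by
  have hfin := fun n => finite_points hconn hdim L n
  obtain ⟨w, hwy, hw⟩ := TateModule.exists_sequence he hp y
  obtain ⟨i, hi⟩ : ∃ i, y.1 i ≠ 0 := by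
    by_contra! h
    exact hy (Subtype.ext (funext h))
  have hne : w (i + 1) ≠ 0 := by
    intro h0
    have h1 := hwy (i + 1)
    rw [h0, map_zero] at h1
    exact hi (TateModule.eq_of_apply_eq (y' := 0)
      (i.le_succ.trans (Nat.le_mul_of_pos_left (i + 1) he)) h1.symm)
  have hp' : ϖ ^ e = (↑u⁻¹ : A) * (p : A) := by rw [hp, Units.inv_mul_cancel_left]
  obtain ⟨D, hD⟩ := exists_pow_le_mul_card_orbit (K := K) hconn hdim hp' hw
    (Nat.le_add_left 1 i) hne
  have hc0 : 0 < c := by omega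
  -- The orbit bound counts from level i+1; the factor c^(s(i+1)) makes up for the missing levels.
  obtain ⟨N, hfib⟩ := exists_forall_mem_orbit_of_smul_eq (Γ := L ≃ₐ[K] L) (L := L)
    (fun _ _ _ => rfl) (fun _ _ _ _ => rfl) hp hw (n₁ := i + 1) (D := c ^ (s * (i + 1)) * D) (by
      intro n hn
      obtain ⟨j, rfl⟩ := Nat.exists_eq_add_of_le hn
      have := hD j
      rw [hN, hM] at this
      rw [hcard]
      refine le_of_mul_le_mul_right ?_ (pow_pos hc0 (g * (i + 1 + j)))
      calc (c ^ ((s - g) * 1)) ^ (i + 1 + j) * c ^ (g * (i + 1 + j))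
          = c ^ (s * (i + 1)) * (c ^ (s * 1)) ^ j := by
            obtain ⟨d, rfl⟩ := Nat.exists_eq_add_of_le hgs
            rw [Nat.add_sub_cancel_left]
            ring
        _ ≤ c ^ (s * (i + 1)) * _ := Nat.mul_le_mul_left _ this
        _ = _ := by ring)
  refine ⟨e * N, fun y' hy' => TateModule.exists_push_eq_of_forall fun m => ?_⟩
  obtain ⟨w', hwy', hw'⟩ := TateModule.exists_sequence he hp y'
  have hN' : w' N = w N := by
    refine Points.comap_injective (G.resLE_surjective (Nat.le_mul_of_pos_left N he)) ?_
    rw [hwy, hwy', hy']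
  have key (n : ℕ) (hn : N ≤ n) : ∃ σ : L ≃ₐ[K] L, σ • w n = w' n := by
    induction n, hn using Nat.le_induction with
    | base => exact ⟨1, by rw [one_smul, hN']⟩
    | succ n hn ih =>
      obtain ⟨σ, hσ⟩ := ih
      -- Moved back by σ, the target lies over w_n, where the stabilizer is transitive.
      obtain ⟨τ, -, hτ⟩ := hfib n hn (σ⁻¹ • w' (n + 1)) (by
        rw [← Points.galois_smul_smul, ← hw', ← Points.comap_galois_smul, ← hσ, inv_smul_smul])
      exact ⟨σ * τ, by rw [mul_smul, hτ, smul_inv_smul]⟩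
  obtain ⟨σ, hσ⟩ := key (max N m) (le_max_left _ _)
  refine ⟨σ, ?_⟩
  refine TateModule.eq_of_apply_eq
    (y := TateModule.push G A ϖ ((σ : L →ₐ[K] L).restrictScalars R) y) (n := e * max N m)
    ((le_max_right N m).trans (Nat.le_mul_of_pos_left _ he)) ?_
  change σ • y.1 (e * max N m) = _
  rw [← hwy, ← hwy', ← hσ]
  rfl

end Monodromy

end PDivisibleGroup

end

/-! ### Open orbits and irreducibility. -/

theorem theorem6p3 {p : ℕ} [Fact p.Prime]
    -- `A` is the ring of integers of a finite extension `E` of `ℚ_p`, with uniformizer `ϖ`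
    {A : Type*} [CommRing A] [IsDomain A] [IsDiscreteValuationRing A] [Algebra ℤ_[p] A]
    [Module.Finite ℤ_[p] A] [FaithfulSMul ℤ_[p] A] {ϖ : A} (hϖ : Irreducible ϖ)
    {E : Type*} [Field E] [Algebra A E] [IsFractionRing A E]
    -- `R` is a complete discrete valuation ring of characteristic `p` with fraction field `K`
    {R : Type*} [CommRing R] [IsDomain R] [IsDiscreteValuationRing R]
    [IsAdicComplete (IsLocalRing.maximalIdeal R) R] [CharP R p] [Algebra A R]
    {K : Type*} [Field K] [Algebra R K] [IsFractionRing R K]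
    -- `G` is a connected one-dimensional `p`-divisible group over `R` with an action of `A`
    (G : PDivisibleGroup p R) [G.RingAction A] (hconn : G.IsConnected) (hdim : G.HasDimension 1)
    (hA : G.IsStrict A)
    -- the special fibre has height `s`, the generic fibre has height `g`, and `1 ≤ g < s`
    {g s : ℕ} (hs : G.HasFormalHeight A (IsLocalRing.ResidueField R) s)
    (hg : G.HasFormalHeight A K g) (hg1 : 1 ≤ g) (hgs : g < s) :
    (∀ y : G.slopeZeroTateModule A ϖ K, y ≠ 0 →
      IsOpen (MulAction.orbit (G.monodromyGroup A ϖ K) y)) ∧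
    (G.slopeZeroRationalRep A ϖ K E).IsIrreducible := by
  have hs0 : s ≠ 0 := by omega
  obtain ⟨c, hc, hN, hM⟩ := PDivisibleGroup.exists_orders_eq_pow hconn hdim hs hg hs0
  have hfin := fun n => PDivisibleGroup.finite_points hconn hdim (AlgebraicClosure K) n
  have hcard (n : ℕ) : Nat.card (G.Points n (AlgebraicClosure K)) = c ^ ((s - g) * n) := by
    have h := PDivisibleGroup.card_points_mul_finrank hconn hdim K (AlgebraicClosure K) n
    rw [hN, hM] at h
    refine Nat.eq_of_mul_eq_mul_right (pow_pos (by omega : 0 < c) (g * n)) (h.trans ?_)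
    rw [← pow_add, ← add_mul, Nat.sub_add_cancel hgs.le]
  have hp0 : (p : A) ≠ 0 := by
    have : CharZero A :=
      charZero_of_injective_algebraMap (FaithfulSMul.algebraMap_injective ℤ_[p] A)
    exact Nat.cast_ne_zero.mpr (Fact.out : p.Prime).ne_zero
  obtain ⟨e, u, hp⟩ := IsDiscreteValuationRing.eq_unit_mul_pow_irreducible hp0 hϖ
  have he : 1 ≤ e := by
    rw [Nat.one_le_iff_ne_zero]
    rintro rfl
    have hunit : IsUnit (p : A) := by
      rw [hp, pow_zero, mul_one]
      exact u.isUnit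
    have := hunit.map (algebraMap A R)
    rw [map_natCast, CharP.cast_eq_zero] at this
    exact not_isUnit_zero this
  have hlevel {y : G.slopeZeroTateModule A ϖ K} (hy : y ≠ 0) :
      ∃ M, ∀ y' : G.slopeZeroTateModule A ϖ K, y'.1 M = y.1 M →
        ∃ σ, G.slopeZeroRep A ϖ K σ y = y' := by
    obtain ⟨M, h⟩ := PDivisibleGroup.TateModule.exists_push_eq_of_apply_eq (K := K) hconn hdim hc
      hgs.le hN hM hcard he u hp hy
    refine ⟨M, fun y' hy' => ?_⟩
    obtain ⟨σ, hσ⟩ := h y' hy'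
    exact ⟨σ, Subtype.ext (funext hσ)⟩
  refine ⟨fun y hy => PDivisibleGroup.TateModule.isOpen_of_forall_exists ?_, ?_⟩
  · rintro _ ⟨γ, rfl⟩
    obtain ⟨M, h⟩ := hlevel ((smul_ne_zero_iff_ne γ).mpr hy)
    refine ⟨M, fun z hz => ?_⟩
    obtain ⟨σ, rfl⟩ := h z hz
    exact ⟨⟨(G.slopeZeroRep A ϖ K).toHomUnits σ, σ, rfl⟩ * γ, mul_smul _ _ _⟩
  · have := PDivisibleGroup.TateModule.isTorsionFree (G := G) (S := AlgebraicClosure K) hϖ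
    have : Nontrivial (G.slopeZeroTateModule A ϖ K) := by
      obtain ⟨y, hy⟩ := PDivisibleGroup.TateModule.exists_ne_zero (G := G) (S := AlgebraicClosure K)
        (fun n => by rw [hcard, hcard, mul_one, pow_mul])
        (by rw [hcard]; exact Nat.one_lt_pow (by omega) hc) he u hp
      exact ⟨y, 0, hy⟩
    refine (G.slopeZeroRep A ϖ K).isIrreducible_extendScalars_of_forall_exists E fun y hy => ?_
    obtain ⟨M, h⟩ := hlevel hy
    -- Multiples of ϖ^M vanish at level M, so adding them does not change the component there.
    refine ⟨ϖ ^ M, pow_ne_zero M hϖ.ne_zero, fun z => h _ ?_⟩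
    change y.1 M + (ϖ ^ M • z).1 M = y.1 M
    rw [PDivisibleGroup.TateModule.smul_apply_zero, add_zero]
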